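/- Let $N\in\mathbb N$, $1<p<N$, $R_1>0$, and write $B_r^c=\{x\in\mathbb R^N:|x|>r\}$. Let $L,K:B_{R_1}^c\to\mathbb R$ be measurable with $L>0$ a.e., $L\in L^1_{\mathrm{loc}}(B_{R_1}^c)$ and $|\{x\in B_{R_1}^c:K(x)>0\}|>0$. Assume condition (A): there are functions $v,w$, measurable and positive a.e. in $(R_1,\infty)$, with $v^{-1/(p-1)},w\in L^1_{\mathrm{loc}}(R_1,\infty)$, $L(x)\ge v(|x|)$ and $|K(x)|\le w(|x|)$ for a.e. $x\in B_{R_1}^c$, such that, with $p'=\frac p{p-1}$, $\rho(r)=r^{N-1}v(r)$ and $\sigma(r)=r^{N-1}w(r)$, $$P(r):=\min\Big\{\Big(\int_{R_1}^r\rho^{1-p'}(\tau)\,d\tau\Big)^{p-1},\Big(\int_r^\infty\rho^{1-p'}(\tau)\,d\tau\Big)^{p-1}\Big\}<\infty\quad\text{for all } r>R_1,\qquad \int_{R_1}^\infty P(r)\sigma(r)\,dr<\infty .$$ Let $\mathcal D_0^{1,p}(B_{R_1}^c;L)$ be the completion of $C_c^1(B_{R_1}^c)$ with respect to the norm $\big(\int_{B_{R_1}^c}L|\nabla\varphi|^p\,dx\big)^{1/p}$,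 realized as a space of functions: it consists of the $u\in L^1_{\mathrm{loc}}(B_{R_1}^c)$ with weak gradient $\nabla u\in L^1_{\mathrm{loc}}(B_{R_1}^c)$ for which there are $\varphi_n\in C_c^1(B_{R_1}^c)$ with $\varphi_n\to u$ in $L^1_{\mathrm{loc}}(B_{R_1}^c)$ and $\int_{B_{R_1}^c}L|\nabla\varphi_n-\nabla u|^p\,dx\to0$. For $\lambda\in\mathbb R$, a (weak) solution of $$-\operatorname{div}(L|\nabla u|^{p-2}\nabla u)=\lambda K|u|^{p-2}u\ \text{ in } B_{R_1}^c,\qquad u=0\ \text{ on }\partial B_{R_1}^c,$$ is a function $u\in\mathcal D_0^{1,p}(B_{R_1}^c;L)$ such that $$\int_{B_{R_1}^c}L|\nabla u|^{p-2}\nabla u\cdot\nabla \psi\,dx=\lambda\int_{B_{R_1}^c}K|u|^{p-2}u\,\psi\,dx\quad\text{for all }\psi\in\mathcal D_0^{1,p}(B_{R_1}^c;L).$$ Assume moreover that there are $R\in(R_1,\infty)$, $q\in\big[p,\frac{Np}{N-p}\big)$ and $r_0\in(0,R-R_1)$ such that, with $t:=\frac q{q-p}$ ($t:=\infty$ if $q=p$),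 $$\operatorname*{ess\,inf}_{x\in B_R^c}L(x)>0,\qquad L,K\in L^{t}_{\mathrm{loc}}(B_R^c),\qquad \operatorname*{ess\,sup}_{x\in B_R^c}\Big[\|L\|_{L^{t}(B(x,r_0))}+\|K\|_{L^{t}(B(x,r_0))}\Big]<\infty .$$ Then for every $\lambda\in\mathbb R$ and every solution $u$ of this problem, $u(x)\to0$ uniformly as $|x|\to\infty$, that is, for every $\varepsilon>0$ there is $\rho\ge R_1$ such that $|u(x)|<\varepsilon$ for a.e. $x$ with $|x|>\rho$. -/

import Mathlib

open MeasureTheory Set Filter Topology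
open scoped ENNReal

noncomputable section

namespace WeightedPLaplacian

/-- The exterior of the closed ball of radius `R` about the origin of `ℝ^N`, that is
`{x : R < |x|}`. It is both the unbounded annulus `A_R^∞` and the set `B_R^c`. -/
def exteriorBall (N : ℕ) (R : ℝ) : Set (EuclideanSpace ℝ (Fin N)) := {x | R < ‖x‖}

/-- `r ↦ (r^{N-1} v(r))^{1-p'}` with `p' = p/(p-1)`. -/
def rhoPow (N : ℕ) (p : ℝ) (v : ℝ → ℝ) (r : ℝ) : ℝ :=
  (r ^ (N - 1) * v r) ^ (1 - p / (p - 1))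

/-- The function `P` on `(R₁, ∞)`:
`P(r) = min {(∫_{R₁}^r ρ^{1-p'})^{p-1}, (∫_r^∞ ρ^{1-p'})^{p-1}}`, with values in `[0, ∞]`. -/
def P (N : ℕ) (p R₁ : ℝ) (v : ℝ → ℝ) (r : ℝ) : ℝ≥0∞ :=
  min ((∫⁻ t in Ioo R₁ r, ENNReal.ofReal (rhoPow N p v t)) ^ (p - 1))
    ((∫⁻ t in Ioi r, ENNReal.ofReal (rhoPow N p v t)) ^ (p - 1))

/-- The standing assumptions on the weights `L` and `K` in the exterior domain `R₁ < |x|`. -/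
structure StandingWeights (N : ℕ) (R₁ : ℝ) (L K : EuclideanSpace ℝ (Fin N) → ℝ) : Prop where
  measurable_L : AEMeasurable L (volume.restrict (exteriorBall N R₁))
  measurable_K : AEMeasurable K (volume.restrict (exteriorBall N R₁))
  pos_L : ∀ᵐ x ∂(volume.restrict (exteriorBall N R₁)), 0 < L x
  locallyIntegrable_L : LocallyIntegrableOn L (exteriorBall N R₁) volume
  pos_K : 0 < volume {x | x ∈ exteriorBall N R₁ ∧ 0 < K x}

/-- Condition (A) in the exterior domain `R₁ < |x|`: there are radial functions `v`, `w` which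
control `L` from below and `|K|` from above and satisfy the integrability conditions. -/
def ConditionA (N : ℕ) (p R₁ : ℝ) (L K : EuclideanSpace ℝ (Fin N) → ℝ) : Prop :=
  ∃ v w : ℝ → ℝ,
    AEMeasurable v (volume.restrict (Ioi R₁)) ∧
    AEMeasurable w (volume.restrict (Ioi R₁)) ∧
    (∀ᵐ r ∂(volume.restrict (Ioi R₁)), 0 < v r ∧ 0 < w r) ∧
    LocallyIntegrableOn (fun r => v r ^ (-(1 / (p - 1)))) (Ioi R₁) volume ∧
    LocallyIntegrableOn w (Ioi R₁) volume ∧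
    (∀ r ∈ Ioi R₁, P N p R₁ v r < ∞) ∧
    (∫⁻ r in Ioi R₁, P N p R₁ v r * ENNReal.ofReal (r ^ (N - 1) * w r)) < ∞ ∧
    (∀ᵐ x ∂(volume.restrict (exteriorBall N R₁)), v ‖x‖ ≤ L x ∧ |K x| ≤ w ‖x‖)

/-- `φ ∈ C_c^k(Ω)`; `k = ⊤` means smooth. -/
def IsTest {N : ℕ} (k : ℕ∞) (Ω : Set (EuclideanSpace ℝ (Fin N)))
    (φ : EuclideanSpace ℝ (Fin N) → ℝ) : Prop :=
  ContDiff ℝ k φ ∧ HasCompactSupport φ ∧ tsupport φ ⊆ Ω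

/-- `u ∈ L^1_loc(Ω)` has the weak gradient `G ∈ L^1_loc(Ω)` in the open set `Ω`. -/
def HasWeakGradient {N : ℕ} (Ω : Set (EuclideanSpace ℝ (Fin N)))
    (u : EuclideanSpace ℝ (Fin N) → ℝ)
    (G : EuclideanSpace ℝ (Fin N) → EuclideanSpace ℝ (Fin N)) : Prop :=
  LocallyIntegrableOn u Ω volume ∧ LocallyIntegrableOn G Ω volume ∧
    ∀ φ, IsTest ⊤ Ω φ → ∫ x in Ω, u x • gradient φ x = - ∫ x in Ω, φ x • G x

/-- `u ∈ D_0^{1,p}(Ω; L)` with weak gradient `G`, where the completion of `C_c^1(Ω)` for the norm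
`(∫_Ω L |∇φ|^p)^{1/p}` is realized as a space of functions: `u` is the limit in `L^1_loc(Ω)` of
functions `φ n ∈ C_c^1(Ω)` whose gradients converge to `G` in the weighted space.
Under condition (A) a Cauchy sequence for this norm converges in `L^1_loc(Ω)`, its gradients
converge there as well, and so the completion is exactly this space. -/
def MemD0 {N : ℕ} (p : ℝ) (Ω : Set (EuclideanSpace ℝ (Fin N)))
    (L : EuclideanSpace ℝ (Fin N) → ℝ) (u : EuclideanSpace ℝ (Fin N) → ℝ)
    (G : EuclideanSpace ℝ (Fin N) → EuclideanSpace ℝ (Fin N)) : Prop :=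
  HasWeakGradient Ω u G ∧
    ∃ φ : ℕ → EuclideanSpace ℝ (Fin N) → ℝ,
      (∀ n, IsTest 1 Ω (φ n)) ∧
      Tendsto (fun n => ∫⁻ x in Ω, ENNReal.ofReal (L x * ‖gradient (φ n) x - G x‖ ^ p))
        atTop (𝓝 0) ∧
      ∀ C : Set (EuclideanSpace ℝ (Fin N)), IsCompact C → C ⊆ Ω →
        Tendsto (fun n => ∫⁻ x in C, ENNReal.ofReal |φ n x - u x|) atTop (𝓝 0)

/-- `u` is a weak solution of `-div(L |∇u|^{p-2} ∇u) = lam K |u|^{p-2} u` in `Ω`,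
`u = 0` on `∂Ω`. -/
def IsWeakSolution {N : ℕ} (p : ℝ) (Ω : Set (EuclideanSpace ℝ (Fin N)))
    (L K : EuclideanSpace ℝ (Fin N) → ℝ) (lam : ℝ)
    (u : EuclideanSpace ℝ (Fin N) → ℝ) : Prop :=
  ∃ G, MemD0 p Ω L u G ∧
    ∀ v H, MemD0 p Ω L v H →
      ∫ x in Ω, L x * (‖G x‖ ^ (p - 2) * inner ℝ (G x) (H x)) =
        lam * ∫ x in Ω, K x * (|u x| ^ (p - 2) * u x * v x)

/-- The exponent `q/(q-p)`, with the convention `q/0 = ∞`. -/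
def weightExponent (p q : ℝ) : ℝ≥0∞ := ENNReal.ofReal q / ENNReal.ofReal (q - p)

/-- `f ∈ L^r_loc(Ω)`. -/
def MemLpLoc {N : ℕ} (r : ℝ≥0∞) (Ω : Set (EuclideanSpace ℝ (Fin N)))
    (f : EuclideanSpace ℝ (Fin N) → ℝ) : Prop :=
  ∀ C : Set (EuclideanSpace ℝ (Fin N)), IsCompact C → C ⊆ Ω → MemLp f r (volume.restrict C)

end WeightedPLaplacian

end

/-!
The proof is De Giorgi's iteration on balls far away from the origin, with constants that do not
depend on the centre of the ball.

Since `L ≥ c > 0` outside the ball of radius `R`, the gradient of a member of the energy space is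
there in unweighted `L^p`. Integrating the gradient along rays (`exists_hardy_constant`) and using
the Gagliardo-Nirenberg-Sobolev inequality, one finds that the test functions `φ n` which
approximate the solution `u` converge to it in `L^{p*}`, `p* = N p / (N - p)`, on compact subsets of
`{R' < |x|}`, `R' > R`, at a rate independent of the set
(`ApproxSolution.exists_eLpNorm_sub_le`). As each `φ n` has compact support, the norm of `u` in
`L^q(B(x, r₀))` tends to zero as `|x| → ∞` (`ApproxSolution.exists_eLpNorm_le_at_infinity`).

It remains to bound `u` pointwise by its local `L^q` norm. The equation is tested with `η^p Φ(φ n)`,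
where `η` is a cutoff function and `Φ` a convex `C^1` function that vanishes below a level; this
test function is itself of class `C^1` with compact support, so that no chain rule for weakly
differentiable functions is needed, and the error made by replacing `∇u` by `∇(φ n)` tends to zero.
The outcome is a Caccioppoli inequality (`lintegral_energy_le`). Together with Sobolev's inequality
and Hölder's inequality for the weights `L, K ∈ L^{q/(q-p)}` it bounds the norm of `(u - k)_+` in
`L^{p*}` of a ball by the norm of `(u - a)_+`, `a < k`, in `L^q` of a larger ball
(`ApproxSolution.exists_one_step_constant`). As `q < p*`, this can be iterated over levels
increasing to `k` and radii decreasing to `r₀ / 2`; the norms then obey a superlinear recursion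
(`exists_fast_decay`), and `u ≤ k` on `B(x, r₀ / 2)` follows once the norm of `u` in
`L^q(B(x, r₀))` is below a threshold that depends on `k` but not on `x`
(`ApproxSolution.exists_smallness`). For a given `k` this is the case for all `x` far from the
origin. The same holds for `-u`.
-/

namespace WeightedPLaplacian

/-! ### Truncations, cutoff functions and elementary inequalities -/

/-- A convex `C^1` substitute for the positive part: `Φ` lies between `(s - k)_+` and `(s - h)_+`,
has slope in `[0, 1]`, and convexity enters only through `Φ s ≤ (s - h)_+ * Φ' s`. -/
theorem exists_smooth_posPart {h k : ℝ} (hk : h < k) :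
    ∃ Φ Φ' : ℝ → ℝ, (∀ s, HasDerivAt Φ (Φ' s) s) ∧ Continuous Φ' ∧
      (∀ s, 0 ≤ Φ' s) ∧ (∀ s, Φ' s ≤ 1) ∧ (∀ s, max (s - k) 0 ≤ Φ s) ∧
      (∀ s, Φ s ≤ max (s - h) 0 * Φ' s) := by
  have hd : 0 < k - h := sub_pos.2 hk
  set g : ℝ → ℝ := fun τ => max 0 (min 1 ((τ - h) / (k - h))) with hg
  have hgc : Continuous g := by fun_prop
  have hg0 : ∀ s, 0 ≤ g s := fun s => le_max_left _ _
  have hg1 : ∀ s, g s ≤ 1 := fun s => max_le zero_le_one (min_le_left _ _)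
  have hgh : ∀ s, s ≤ h → g s = 0 := by
    intro s hs
    apply max_eq_left
    exact (min_le_right _ _).trans (div_nonpos_of_nonpos_of_nonneg (by linarith) hd.le)
  have hgk : ∀ s, k ≤ s → g s = 1 := by
    intro s hs
    have : 1 ≤ (s - h) / (k - h) := by rw [le_div_iff₀ hd]; linarith
    simp [hg, min_eq_left this]
  have hgm : Monotone g := by
    intro a b hab
    apply max_le_max le_rfl (min_le_min le_rfl _)
    gcongr
  have hint : ∀ a b, IntervalIntegrable g volume a b := fun a b => hgc.intervalIntegrable a b
  have hzero : ∀ s, s ≤ h → ∫ τ in h..s, g τ = 0 := by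
    intro s hs
    rw [intervalIntegral.integral_congr (g := fun _ => (0 : ℝ))]
    · simp
    · intro τ hτ
      rw [uIcc_of_ge hs] at hτ
      exact hgh τ hτ.2
  have hnn : ∀ s, 0 ≤ ∫ τ in h..s, g τ := by
    intro s
    rcases le_total s h with hs | hs
    · exact (hzero s hs).ge
    · exact intervalIntegral.integral_nonneg hs fun τ _ => hg0 τ
  refine ⟨fun s => ∫ τ in h..s, g τ, g, fun s => ?_, hgc, hg0, hg1, fun s => ?_, fun s => ?_⟩
  · exact intervalIntegral.integral_hasDerivAt_right (hint _ _)
      (hgc.stronglyMeasurableAtFilter _ _) hgc.continuousAt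
  · refine max_le ?_ (hnn s)
    rcases le_total s k with hs | hs
    · exact (sub_nonpos.2 hs).trans (hnn s)
    · change s - k ≤ ∫ τ in h..s, g τ
      rw [← intervalIntegral.integral_add_adjacent_intervals (hint h k) (hint k s)]
      have : ∫ τ in k..s, g τ = s - k := by
        rw [intervalIntegral.integral_congr (g := fun _ => (1 : ℝ))]
        · simp
        · intro τ hτ
          rw [uIcc_of_le hs] at hτ
          exact hgk τ hτ.1
      have := hnn k
      linarith
  · rcases le_total s h with hs | hs
    · simp [hzero s hs, hgh s hs]
    · rw [max_eq_left (sub_nonneg.2 hs)]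
      calc ∫ τ in h..s, g τ ≤ ∫ _ in h..s, g s :=
            intervalIntegral.integral_mono_on hs (hint _ _) (by simp) fun τ hτ => hgm hτ.2
        _ = (s - h) * g s := by simp

theorem exists_deriv_smoothTransition_bound :
    ∃ M : ℝ, 0 < M ∧ ∀ t, ‖deriv Real.smoothTransition t‖ ≤ M := by
  have hc : Continuous (deriv Real.smoothTransition) :=
    (Real.smoothTransition.contDiff (n := 1)).continuous_deriv le_rfl
  obtain ⟨M, hM⟩ := isCompact_Icc.exists_bound_of_continuousOn (s := Icc (0 : ℝ) 1) hc.continuousOn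
  refine ⟨max M 1, by positivity, fun t => ?_⟩
  by_cases ht : t ∈ Icc (0 : ℝ) 1
  · exact (hM t ht).trans (le_max_left _ _)
  · have : deriv Real.smoothTransition t = 0 := by
      rw [mem_Icc, not_and_or, not_le, not_le] at ht
      rcases ht with ht | ht
      · have : Real.smoothTransition =ᶠ[𝓝 t] fun _ => 0 := by
          filter_upwards [Iio_mem_nhds ht] with s hs
          exact Real.smoothTransition.zero_of_nonpos (le_of_lt hs)
        simp [this.deriv_eq]
      · have : Real.smoothTransition =ᶠ[𝓝 t] fun _ => 1 := by
          filter_upwards [Ioi_mem_nhds ht] with s hs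
          exact Real.smoothTransition.one_of_one_le (le_of_lt hs)
        simp [this.deriv_eq]
    simp [this]

/-- Cutoff functions between concentric balls; the constant `D` in the gradient bound depends
neither on the centre nor on the radii. -/
theorem exists_cutoff (N : ℕ) :
    ∃ D : ℝ, 0 < D ∧ ∀ (x₀ : EuclideanSpace ℝ (Fin N)) (s r : ℝ), 0 ≤ s → s < r →
      ∃ η : EuclideanSpace ℝ (Fin N) → ℝ, ContDiff ℝ 1 η ∧ (∀ y, 0 ≤ η y) ∧ (∀ y, η y ≤ 1) ∧
        (∀ y ∈ Metric.closedBall x₀ s, η y = 1) ∧ (∀ y ∉ Metric.ball x₀ r, η y = 0) ∧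
        (∀ y, ‖gradient η y‖ ≤ D / (r - s)) ∧ (∀ y ∉ Metric.ball x₀ r, gradient η y = 0) := by
  obtain ⟨M, hM0, hM⟩ := exists_deriv_smoothTransition_bound
  refine ⟨2 * M, by positivity, fun x₀ s r hs hsr => ?_⟩
  have hd : 0 < r ^ 2 - s ^ 2 := by nlinarith
  set A : EuclideanSpace ℝ (Fin N) → ℝ := fun y => (r ^ 2 - ‖y - x₀‖ ^ 2) / (r ^ 2 - s ^ 2) with hA
  have hAd : ContDiff ℝ 1 A := by
    have : ContDiff ℝ 1 fun y : EuclideanSpace ℝ (Fin N) => ‖y - x₀‖ ^ 2 :=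
      (contDiff_id.sub contDiff_const).norm_sq ℝ
    exact (contDiff_const.sub this).div_const _
  have hAf : ∀ y, HasGradientAt A (-(2 / (r ^ 2 - s ^ 2)) • (y - x₀)) y := by
    intro y
    have h1 := ((hasFDerivAt_id y).sub_const x₀).norm_sq
    have h2 := ((hasFDerivAt_const (r ^ 2) y).sub h1).mul_const (r ^ 2 - s ^ 2)⁻¹
    rw [hasGradientAt_iff_hasFDerivAt]
    have hA' : A = fun y => (r ^ 2 - ‖y - x₀‖ ^ 2) * (r ^ 2 - s ^ 2)⁻¹ := by
      funext y; exact div_eq_mul_inv _ _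
    rw [hA']
    refine h2.congr_fderiv ?_
    ext v
    simp only [id_eq, smul_apply, sub_apply,
      zero_apply, ContinuousLinearMap.comp_apply, innerSL_apply_apply,
      ContinuousLinearMap.id_apply, InnerProductSpace.toDual_apply_apply, inner_smul_left, smul_eq_mul,
      nsmul_eq_mul, RCLike.conj_to_real]
    push_cast
    ring
  have hη : ∀ y, HasGradientAt (fun y => Real.smoothTransition (A y))
      (deriv Real.smoothTransition (A y) • (-(2 / (r ^ 2 - s ^ 2)) • (y - x₀))) y := by
    intro y
    have h1 : HasDerivAt Real.smoothTransition (deriv Real.smoothTransition (A y)) (A y) :=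
      ((Real.smoothTransition.contDiff (n := 1)).differentiable one_ne_zero _).hasDerivAt
    have := h1.comp_hasFDerivAt y (hasGradientAt_iff_hasFDerivAt.1 (hAf y))
    rw [hasGradientAt_iff_hasFDerivAt]
    refine this.congr_fderiv ?_
    exact (LinearMap.map_smulₛₗ (InnerProductSpace.toDual ℝ _).toLinearEquiv.toLinearMap _ _).symm
  have hA0 : ∀ y ∉ Metric.ball x₀ r, A y ≤ 0 := by
    intro y hy
    rw [Metric.mem_ball, not_lt, dist_eq_norm] at hy
    apply div_nonpos_of_nonpos_of_nonneg _ hd.le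
    nlinarith
  have hout : ∀ y ∉ Metric.ball x₀ r, gradient (fun y => Real.smoothTransition (A y)) y = 0 := by
    intro y hy
    rw [(hη y).gradient]
    have : IsLocalMin Real.smoothTransition (A y) := by
      filter_upwards with z
      rw [Real.smoothTransition.zero_of_nonpos (hA0 y hy)]
      exact Real.smoothTransition.nonneg z
    rw [this.deriv_eq_zero, zero_smul]
  refine ⟨fun y => Real.smoothTransition (A y), ?_, fun y => Real.smoothTransition.nonneg _,
    fun y => Real.smoothTransition.le_one _, ?_, ?_, ?_, hout⟩
  · exact (Real.smoothTransition.contDiff (n := 1)).comp hAd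
  · intro y hy
    apply Real.smoothTransition.one_of_one_le
    rw [Metric.mem_closedBall, dist_eq_norm] at hy
    rw [hA, le_div_iff₀ hd]
    have := norm_nonneg (y - x₀)
    nlinarith
  · intro y hy
    exact Real.smoothTransition.zero_of_nonpos (hA0 y hy)
  · intro y
    by_cases hy : y ∈ Metric.ball x₀ r
    · rw [(hη y).gradient, norm_smul, norm_smul, norm_neg,
        Real.norm_of_nonneg (show 0 ≤ 2 / (r ^ 2 - s ^ 2) from div_nonneg zero_le_two hd.le)]
      rw [Metric.mem_ball, dist_eq_norm] at hy
      have h1 : 2 / (r ^ 2 - s ^ 2) * ‖y - x₀‖ ≤ 2 / (r - s) := by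
        rw [div_mul_eq_mul_div, div_le_div_iff₀ hd (by linarith)]
        have : r ^ 2 - s ^ 2 = (r + s) * (r - s) := by ring
        rw [this]
        have h3 : 0 < r - s := by linarith
        nlinarith [mul_le_mul_of_nonneg_right (show ‖y - x₀‖ ≤ r + s by linarith) h3.le]
      calc _ ≤ M * (2 / (r - s)) := mul_le_mul (hM _) h1
            (mul_nonneg (div_nonneg zero_le_two hd.le) (norm_nonneg _)) hM0.le
        _ = _ := by ring
    · rw [hout y hy, norm_zero]
      exact div_nonneg (by positivity) (by linarith)

/-- Young's inequality with an explicit constant. -/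
theorem mul_rpow_mul_le {p A b : ℝ} (hp : 1 < p) (hA : 0 ≤ A) (hb : 0 ≤ b) :
    p * A ^ (p - 1) * b ≤ 1 / 2 * A ^ p + (2 * p) ^ p * b ^ p := by
  have hp0 : 0 < p := by linarith
  have hAp : 0 ≤ A ^ p := by positivity
  have hbp : 0 ≤ (2 * p) ^ p * b ^ p := by positivity
  rcases le_total (2 * p * b) A with h | h
  · have : A ^ p = A ^ (p - 1) * A := by
      rw [← Real.rpow_add_one' hA (by linarith)]; ring_nf
    have h2 : A ^ (p - 1) * (2 * p * b) ≤ A ^ (p - 1) * A := by gcongr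
    linarith
  · have h1 : A ^ (p - 1) ≤ (2 * p * b) ^ (p - 1) :=
      Real.rpow_le_rpow hA h (by linarith)
    have h2 : (2 * p * b) ^ (p - 1) * (2 * p * b) = (2 * p) ^ p * b ^ p := by
      rw [← Real.rpow_add_one' (by positivity) (by linarith), ← Real.mul_rpow (by positivity) hb]
      ring_nf
    have h3 : A ^ (p - 1) * (2 * p * b) ≤ (2 * p * b) ^ (p - 1) * (2 * p * b) := by gcongr
    have : 0 ≤ A ^ (p - 1) * (p * b) := by positivity
    linarith

theorem add_add_rpow_le {p a b c : ℝ} (hp : 0 ≤ p) (ha : 0 ≤ a) (hb : 0 ≤ b) (hc : 0 ≤ c) :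
    (a + b + c) ^ p ≤ 3 ^ p * (a ^ p + b ^ p + c ^ p) := by
  have key : ∀ m, 0 ≤ m → a ≤ m → b ≤ m → c ≤ m → m ^ p ≤ a ^ p + b ^ p + c ^ p →
      (a + b + c) ^ p ≤ 3 ^ p * (a ^ p + b ^ p + c ^ p) := by
    intro m hm h1 h2 h3 h4
    calc (a + b + c) ^ p ≤ (3 * m) ^ p := Real.rpow_le_rpow (by positivity) (by linarith) hp
      _ = 3 ^ p * m ^ p := Real.mul_rpow (by norm_num) hm
      _ ≤ _ := by gcongr
  have h1 : 0 ≤ a ^ p := by positivity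
  have h2 : 0 ≤ b ^ p := by positivity
  have h3 : 0 ≤ c ^ p := by positivity
  rcases le_total a b with hab | hab <;> rcases le_total b c with hbc | hbc <;>
    rcases le_total a c with hac | hac
  · exact key c hc hac hbc le_rfl (by linarith)
  · exact key c hc (hab.trans hbc) hbc le_rfl (by linarith)
  · exact key b hb hab le_rfl hbc (by linarith)
  · exact key b hb hab le_rfl hbc (by linarith)
  · exact key c hc hac hbc le_rfl (by linarith)
  · exact key a ha le_rfl hab hac (by linarith)
  · exact key a ha le_rfl hab (hbc.trans hab) (by linarith)
  · exact key a ha le_rfl hab hac (by linarith)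

theorem norm_rpow_sub_two_mul_norm {V : Type*} [NormedAddCommGroup V] {p : ℝ} (hp : 1 < p) (G : V) :
    ‖G‖ ^ (p - 2) * ‖G‖ = ‖G‖ ^ (p - 1) := by
  rcases eq_or_ne (‖G‖) 0 with h | h
  · rw [h, Real.zero_rpow (by linarith : p - 1 ≠ 0)]; ring
  · rw [← Real.rpow_add_one h]; congr 1; ring

theorem abs_flux_le {V : Type*} [NormedAddCommGroup V] [InnerProductSpace ℝ V] {p : ℝ} (hp : 1 < p)
    (G z : V) : |‖G‖ ^ (p - 2) * inner ℝ G z| ≤ ‖G‖ ^ (p - 1) * ‖z‖ := by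
  rw [abs_mul, abs_of_nonneg (by positivity), ← norm_rpow_sub_two_mul_norm hp, mul_assoc]
  gcongr
  exact abs_real_inner_le_norm G z

/-- The pointwise form of the Caccioppoli inequality. Here `g` and `e` are the gradients of a test
function and of the cutoff function `η`, and `φ`, `φ'`, `x` are the values of the truncation, of its
derivative and of the positive part. On the left is the gradient of `η Φ`, on the right the flux
of `G` paired with the gradient of `η^p Φ`, and error terms for `g - G` and for `e`. -/
theorem pointwise_energy {V : Type*} [NormedAddCommGroup V] [InnerProductSpace ℝ V]
    {p η φ φ' x : ℝ} (hp : 1 < p) (hη0 : 0 ≤ η) (hη1 : η ≤ 1) (hφ0 : 0 ≤ φ) (hx : 0 ≤ x)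
    (h0 : 0 ≤ φ') (h1 : φ' ≤ 1) (hφ : φ ≤ x * φ') (G g e : V) :
    ‖(η * φ') • g + φ • e‖ ^ p ≤ 3 ^ p *
      (2 * (‖G‖ ^ (p - 2) * inner ℝ G ((η ^ p * φ') • g + (p * η ^ (p - 1) * φ) • e)) +
        (2 * (‖G‖ ^ (p - 1) * ‖g - G‖) + ‖g - G‖ ^ p +
          (2 * (2 * p) ^ p + 1) * (‖e‖ ^ p * x ^ p))) := by
  have hp0 : 0 < p := by linarith
  set A := η * ‖G‖ with hA
  set b := ‖e‖ * x with hb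
  have hA0 : 0 ≤ A := by positivity
  have hb0 : 0 ≤ b := by positivity
  have hηp : η ^ p ≤ 1 := Real.rpow_le_one hη0 hη1 hp0.le
  have hηp0 : 0 ≤ η ^ p := by positivity
  have hbp : ‖e‖ ^ p * x ^ p = b ^ p := (Real.mul_rpow (norm_nonneg _) hx).symm
  have hφx : φ ≤ x := hφ.trans (mul_le_of_le_one_right hx h1)
  -- the gradient of the truncated function
  have step1 : ‖(η * φ') • g + φ • e‖ ^ p ≤ 3 ^ p * (φ' * A ^ p + ‖g - G‖ ^ p + b ^ p) := by
    have hle : ‖(η * φ') • g + φ • e‖ ≤ A * φ' + ‖g - G‖ + b := by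
      have : (η * φ') • g + φ • e = (η * φ') • G + (η * φ') • (g - G) + φ • e := by
        rw [smul_sub]; abel
      rw [this]
      refine (norm_add₃_le).trans ?_
      rw [norm_smul, norm_smul, norm_smul, Real.norm_of_nonneg (by positivity : 0 ≤ η * φ'),
        Real.norm_of_nonneg hφ0]
      have e1 : η * φ' * ‖G‖ = A * φ' := by rw [hA]; ring
      have e2 : η * φ' * ‖g - G‖ ≤ ‖g - G‖ :=
        mul_le_of_le_one_left (norm_nonneg _) (mul_le_one₀ hη1 h0 h1)
      have e3 : φ * ‖e‖ ≤ b := by rw [hb, mul_comm]; gcongr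
      linarith
    calc _ ≤ (A * φ' + ‖g - G‖ + b) ^ p := Real.rpow_le_rpow (norm_nonneg _) hle hp0.le
      _ ≤ 3 ^ p * ((A * φ') ^ p + ‖g - G‖ ^ p + b ^ p) :=
        add_add_rpow_le hp0.le (by positivity) (norm_nonneg _) hb0
      _ ≤ _ := by
        have : φ' ^ p ≤ φ' := by
          simpa using Real.rpow_le_rpow_of_exponent_ge' h0 h1 zero_le_one hp.le
        have h5 : (A * φ') ^ p ≤ φ' * A ^ p := by
          rw [Real.mul_rpow hA0 h0, mul_comm]; gcongr
        gcongr
  -- the coercivity of the flux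
  have hGG : ‖G‖ ^ (p - 2) * (‖G‖ * ‖G‖) = ‖G‖ ^ p := by
    rw [← mul_assoc, norm_rpow_sub_two_mul_norm hp,
      ← Real.rpow_add_one' (norm_nonneg _) (by linarith)]
    congr 1; ring
  have hin : ∀ z : V, -(‖G‖ ^ (p - 1) * ‖z‖) ≤ ‖G‖ ^ (p - 2) * inner ℝ G z :=
    fun z => (abs_le.1 (abs_flux_le hp G z)).1
  have step2 : 1 / 2 * (φ' * A ^ p) ≤
      ‖G‖ ^ (p - 2) * inner ℝ G ((η ^ p * φ') • g + (p * η ^ (p - 1) * φ) • e) +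
        ‖G‖ ^ (p - 1) * ‖g - G‖ + (2 * p) ^ p * b ^ p := by
    have hdec : ‖G‖ ^ (p - 2) * inner ℝ G ((η ^ p * φ') • g + (p * η ^ (p - 1) * φ) • e) =
        φ' * A ^ p + η ^ p * φ' * (‖G‖ ^ (p - 2) * inner ℝ G (g - G)) +
          p * η ^ (p - 1) * φ * (‖G‖ ^ (p - 2) * inner ℝ G e) := by
      rw [hA, Real.mul_rpow hη0 (norm_nonneg _), ← hGG, inner_add_right, inner_smul_right,
        inner_smul_right, inner_sub_right, real_inner_self_eq_norm_mul_norm]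
      ring
    have t1 : -(‖G‖ ^ (p - 1) * ‖g - G‖) ≤
        η ^ p * φ' * (‖G‖ ^ (p - 2) * inner ℝ G (g - G)) := by
      have h7 : η ^ p * φ' ≤ 1 := mul_le_one₀ hηp h0 h1
      have h8 := hin (g - G)
      have h9 : 0 ≤ ‖G‖ ^ (p - 1) * ‖g - G‖ := by positivity
      have h10 : 0 ≤ η ^ p * φ' := by positivity
      nlinarith [mul_le_mul_of_nonneg_left h8 h10]
    have t2 : -(φ' * (1 / 2 * A ^ p + (2 * p) ^ p * b ^ p)) ≤
        p * η ^ (p - 1) * φ * (‖G‖ ^ (p - 2) * inner ℝ G e) := by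
      have h8 := hin e
      have h11 : 0 ≤ p * η ^ (p - 1) * φ := by positivity
      have h12 := mul_le_mul_of_nonneg_left h8 h11
      have h13 := mul_rpow_mul_le hp hA0 hb0
      have h14 : p * η ^ (p - 1) * φ * (‖G‖ ^ (p - 1) * ‖e‖) ≤ φ' * (p * A ^ (p - 1) * b) := by
        rw [hA, Real.mul_rpow hη0 (norm_nonneg _)]
        calc _ = p * η ^ (p - 1) * (‖G‖ ^ (p - 1) * ‖e‖) * φ := by ring
          _ ≤ p * η ^ (p - 1) * (‖G‖ ^ (p - 1) * ‖e‖) * (x * φ') := by gcongr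
          _ = _ := by rw [hb]; ring
      nlinarith [mul_le_mul_of_nonneg_left h13 h0]
    have t3 : φ' * ((2 * p) ^ p * b ^ p) ≤ (2 * p) ^ p * b ^ p :=
      mul_le_of_le_one_left (by positivity) h1
    rw [hdec]
    nlinarith
  rw [hbp]
  refine step1.trans (mul_le_mul_of_nonneg_left ?_ (by positivity))
  linarith

/-- Fast geometric convergence: a superlinear recursion whose factor grows geometrically forces
convergence to zero if the first term is small. -/
theorem exists_fast_decay {C B α : ℝ} (hC : 0 < C) (hB : 1 < B) (hα : 0 < α) :
    ∃ δ : ℝ≥0∞, 0 < δ ∧ ∀ Y : ℕ → ℝ≥0∞, Y 0 ≤ δ →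
      (∀ j, Y (j + 1) ≤ ENNReal.ofReal (C * B ^ j) * Y j ^ (1 + α)) →
      Tendsto Y atTop (𝓝 0) := by
  have hB0 : 0 < B := by linarith
  -- `b` is chosen with `B * b ^ α = 1` and `d` with `C * d ^ α = b`: then `Y j ≤ d * b ^ j`
  set b : ℝ := B ^ (-(1 / α)) with hb
  have hb0 : 0 < b := by positivity
  have hb1 : b < 1 := Real.rpow_lt_one_of_one_lt_of_neg hB (by simpa using hα)
  have hbα : B * b ^ α = 1 := by
    rw [hb, ← Real.rpow_mul hB0.le]
    have : -(1 / α) * α = -1 := by field_simp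
    rw [this, Real.rpow_neg_one, mul_inv_cancel₀ hB0.ne']
  set d : ℝ := (b / C) ^ (1 / α) with hd
  have hd0 : 0 < d := by positivity
  have hdα : C * d ^ α = b := by
    rw [hd, ← Real.rpow_mul (by positivity)]
    have : 1 / α * α = 1 := by field_simp
    rw [this, Real.rpow_one]; field_simp
  refine ⟨ENNReal.ofReal d, by simpa using hd0, fun Y h0 hY => ?_⟩
  have key : ∀ j, Y j ≤ ENNReal.ofReal (d * b ^ j) := by
    intro j
    induction j with
    | zero => simpa using h0
    | succ j ih =>
      calc Y (j + 1) ≤ ENNReal.ofReal (C * B ^ j) * Y j ^ (1 + α) := hY j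
        _ ≤ ENNReal.ofReal (C * B ^ j) * (ENNReal.ofReal (d * b ^ j)) ^ (1 + α) := by gcongr
        _ = ENNReal.ofReal (C * B ^ j * (d * b ^ j) ^ (1 + α)) := by
          rw [ENNReal.ofReal_rpow_of_nonneg (by positivity) (by linarith),
            ← ENNReal.ofReal_mul (by positivity)]
        _ = ENNReal.ofReal (d * b ^ (j + 1)) := by
          congr 1
          rw [Real.rpow_add (by positivity), Real.rpow_one, Real.mul_rpow hd0.le (by positivity),
            ← Real.rpow_natCast b j, ← Real.rpow_mul hb0.le, mul_comm (j : ℝ) α,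
            Real.rpow_mul hb0.le, Real.rpow_natCast, Real.rpow_natCast]
          calc _ = d * b ^ j * (C * d ^ α) * (B * b ^ α) ^ j := by rw [mul_pow]; ring
            _ = _ := by rw [hdα, hbα]; ring
  have hlim : Tendsto (fun j : ℕ => ENNReal.ofReal (d * b ^ j)) atTop (𝓝 0) := by
    have := (tendsto_pow_atTop_nhds_zero_of_lt_one hb0.le hb1).const_mul d
    rw [mul_zero] at this
    simpa using ENNReal.tendsto_ofReal this
  exact tendsto_of_tendsto_of_tendsto_of_le_of_le tendsto_const_nhds hlim (fun _ => zero_le) key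

/-! ### Hardy and Sobolev inequalities outside a ball -/

theorem enorm_gradient {N : ℕ} (f : EuclideanSpace ℝ (Fin N) → ℝ) (x : EuclideanSpace ℝ (Fin N)) :
    ‖gradient f x‖ₑ = ‖fderiv ℝ f x‖ₑ := by
  rw [gradient]
  exact enorm_eq_iff_norm_eq.2 (LinearIsometryEquiv.norm_map _ _)

theorem continuous_gradient {N : ℕ} {f : EuclideanSpace ℝ (Fin N) → ℝ} (hf : ContDiff ℝ 1 f) :
    Continuous (gradient f) :=
  (LinearIsometryEquiv.continuous _).comp (hf.continuous_fderiv one_ne_zero)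

theorem measurableSet_exteriorBall (N : ℕ) (R : ℝ) : MeasurableSet (exteriorBall N R) :=
  measurableSet_lt measurable_const measurable_norm

/-- The fundamental theorem of calculus along the ray from `x` to infinity. -/
theorem enorm_le_lintegral_ray {N : ℕ} {ψ : EuclideanSpace ℝ (Fin N) → ℝ} (hψ : ContDiff ℝ 1 ψ)
    (hc : HasCompactSupport ψ) {x : EuclideanSpace ℝ (Fin N)} (hx : x ≠ 0) :
    ‖ψ x‖ₑ ≤ ∫⁻ s in Ici (1 : ℝ), ‖x‖ₑ * ‖gradient ψ (s • x)‖ₑ := by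
  have hlin : ContDiff ℝ 1 fun s : ℝ => (-s) • x := by fun_prop
  have hemb : Topology.IsClosedEmbedding fun s : ℝ => (-s) • x := by
    have h1 := (isClosedEmbedding_smul_left (𝕜 := ℝ) hx)
    exact h1.comp (Homeomorph.neg ℝ).isClosedEmbedding
  have h1 := HasCompactSupport.enorm_le_lintegral_Ici_deriv (hψ.comp hlin)
    (hc.comp_isClosedEmbedding hemb) (-1)
  simp only [Function.comp_apply, neg_neg, one_smul] at h1
  refine h1.trans ?_
  have h2 : ∀ s : ℝ, ‖deriv (ψ ∘ fun s : ℝ => (-s) • x) s‖ₑ ≤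
      ‖x‖ₑ * ‖gradient ψ ((-s) • x)‖ₑ := by
    intro s
    have h3 : HasDerivAt (fun s : ℝ => (-s) • x) ((-1 : ℝ) • x) s :=
      (hasDerivAt_neg s).smul_const x
    have h4 := (hψ.differentiable one_ne_zero ((-s) • x)).hasFDerivAt.comp_hasDerivAt s h3
    rw [h4.deriv, enorm_gradient, mul_comm]
    refine (ContinuousLinearMap.le_opENorm _ _).trans ?_
    simp
  calc ∫⁻ s in Iic (-1 : ℝ), ‖deriv (ψ ∘ fun s : ℝ => (-s) • x) s‖ₑ
      ≤ ∫⁻ s in Iic (-1 : ℝ), ‖x‖ₑ * ‖gradient ψ ((-s) • x)‖ₑ := lintegral_mono fun s => h2 s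
    _ = ∫⁻ s in Neg.neg ⁻¹' (Ici (1 : ℝ)), ‖x‖ₑ * ‖gradient ψ ((-s) • x)‖ₑ := by
        congr 2; ext s; simp [le_neg]
    _ = ∫⁻ s in Ici (1 : ℝ), ‖x‖ₑ * ‖gradient ψ (s • x)‖ₑ :=
        (Measure.measurePreserving_neg (volume : Measure ℝ)).setLIntegral_comp_preimage
          (f := fun s => ‖x‖ₑ * ‖gradient ψ (s • x)‖ₑ) measurableSet_Ici
          (by
            have := (continuous_gradient hψ)
            have h5 : Continuous fun s : ℝ => gradient ψ (s • x) := this.comp (by fun_prop)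
            exact h5.measurable.enorm.const_mul _)

/-- Dilations by factors `s ≥ 1` map the exterior of a ball into itself. -/
theorem lintegral_exteriorBall_comp_smul_le {N : ℕ} {R s : ℝ} (hR : 0 < R) (hs : 1 ≤ s)
    {F : EuclideanSpace ℝ (Fin N) → ℝ≥0∞} (hF : Measurable F) :
    ∫⁻ x in exteriorBall N R, F (s • x) ≤
      ENNReal.ofReal (s ^ (-(N : ℝ))) * ∫⁻ x in exteriorBall N R, F x := by
  have hs0 : 0 < s := by linarith
  have hm := measurableSet_exteriorBall N R
  rw [← lintegral_indicator hm, ← lintegral_indicator hm]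
  calc ∫⁻ x, (exteriorBall N R).indicator (fun x => F (s • x)) x
      ≤ ∫⁻ x, (exteriorBall N R).indicator F (s • x) := by
        refine lintegral_mono fun x => ?_
        by_cases hx : x ∈ exteriorBall N R
        · have : s • x ∈ exteriorBall N R := by
            simp only [exteriorBall, mem_ofPred_eq] at hx ⊢
            rw [norm_smul, Real.norm_of_nonneg hs0.le]
            nlinarith
          rw [indicator_of_mem hx, indicator_of_mem this]
        · rw [indicator_of_notMem hx]; exact zero_le
    _ = ∫⁻ y, (exteriorBall N R).indicator F y ∂(Measure.map (fun x => s • x) volume) :=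
        (lintegral_map (hF.indicator hm) (measurable_const_smul s)).symm
    _ = _ := by
        rw [Measure.map_addHaar_smul _ hs0.ne', lintegral_smul_measure, finrank_euclideanSpace_fin,
          smul_eq_mul, abs_of_pos (by positivity), Real.rpow_neg hs0.le, Real.rpow_natCast]

/-- A Hardy type inequality: in an annulus, a function with compact support is controlled by its
gradient in the exterior of the inner ball, without any condition on the inner sphere. -/
theorem exists_hardy_constant {N : ℕ} {p R : ℝ} (R' : ℝ) (hp : 1 < p) (hpN : p < N) (hR : 0 < R) :
    ∃ C : ℝ≥0∞, C ≠ ∞ ∧ ∀ ψ : EuclideanSpace ℝ (Fin N) → ℝ, ContDiff ℝ 1 ψ → HasCompactSupport ψ →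
      ∫⁻ x in exteriorBall N R ∩ Metric.closedBall 0 R', ‖ψ x‖ₑ ^ p ≤
        C * ∫⁻ x in exteriorBall N R, ‖gradient ψ x‖ₑ ^ p := by
  have hp0 : 0 < p := by linarith
  have hp1 : 0 < p - 1 := by linarith
  -- the weight `s ^ b` on the ray: `b > p - 1` makes the dual integral `A₁` converge, and
  -- `b < N - 1` the integral `A₂` in which the Jacobian `s ^ (-N)` of the dilation appears
  set b : ℝ := (p + N - 2) / 2 with hb
  have hb1 : p - 1 < b := by rw [hb]; linarith
  have hbN : b - N < -1 := by rw [hb]; linarith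
  have hconj : p.conjExponent.HolderConjugate p := (Real.HolderConjugate.conjExponent hp).symm
  have hp' : p.conjExponent = p / (p - 1) := rfl
  have fin1 : ∀ c : ℝ, c < -1 → ∫⁻ s in Ici (1 : ℝ), ENNReal.ofReal (s ^ c) ≠ ∞ := by
    intro c hc
    have := (integrableOn_Ioi_rpow_of_lt hc one_pos)
    rw [← integrableOn_Ici_iff_integrableOn_Ioi] at this
    exact this.setLIntegral_lt_top.ne
  set A₁ := ∫⁻ s in Ici (1 : ℝ), ENNReal.ofReal (s ^ (-(b / (p - 1)))) with hA₁
  set A₂ := ∫⁻ s in Ici (1 : ℝ), ENNReal.ofReal (s ^ (b - N)) with hA₂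
  have hA₁f : A₁ ≠ ∞ := fin1 _ (by rw [neg_lt_neg_iff, one_lt_div hp1]; exact hb1)
  have hA₂f : A₂ ≠ ∞ := fin1 _ hbN
  refine ⟨A₁ ^ (p - 1) * (ENNReal.ofReal R' ^ p * A₂), ?_, fun ψ hψ hc => ?_⟩
  · refine ENNReal.mul_ne_top (ENNReal.rpow_ne_top_of_nonneg hp1.le hA₁f)
      (ENNReal.mul_ne_top (ENNReal.rpow_ne_top_of_nonneg hp0.le ENNReal.ofReal_ne_top) hA₂f)
  set S := exteriorBall N R ∩ Metric.closedBall 0 R' with hS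
  have hSm : MeasurableSet S := (measurableSet_exteriorBall N R).inter measurableSet_closedBall
  have hgc := continuous_gradient hψ
  set W : ℝ → EuclideanSpace ℝ (Fin N) → ℝ≥0∞ :=
    fun s x => ENNReal.ofReal (s ^ b) * ‖gradient ψ (s • x)‖ₑ ^ p with hW
  have hWm : Measurable (Function.uncurry W) := by
    have h1 : Measurable fun z : ℝ × EuclideanSpace ℝ (Fin N) => gradient ψ (z.1 • z.2) :=
      (hgc.comp (by fun_prop)).measurable
    have h2 : Measurable fun z : ℝ × EuclideanSpace ℝ (Fin N) => ENNReal.ofReal (z.1 ^ b) := by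
      fun_prop
    exact h2.mul (h1.enorm.pow_const p)
  -- Hölder's inequality on the ray through `x`
  have hpt : ∀ x ∈ S, ‖ψ x‖ₑ ^ p ≤
      A₁ ^ (p - 1) * (ENNReal.ofReal R' ^ p * ∫⁻ s in Ici (1 : ℝ), W s x) := by
    intro x hx
    have hx0 : x ≠ 0 := by
      rintro rfl
      have := hx.1
      simp only [exteriorBall, mem_ofPred_eq, norm_zero] at this
      linarith
    have hxR : ‖x‖ₑ ≤ ENNReal.ofReal R' := by
      rw [← ofReal_norm]
      exact ENNReal.ofReal_le_ofReal (by simpa using hx.2)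
    have hgx : Measurable fun s : ℝ => gradient ψ (s • x) :=
      (hgc.comp (by fun_prop)).measurable
    set f : ℝ → ℝ≥0∞ := fun s => ENNReal.ofReal (s ^ (-(b / p)))
    set g : ℝ → ℝ≥0∞ := fun s => ENNReal.ofReal (s ^ (b / p)) * ‖gradient ψ (s • x)‖ₑ
    have h1 : ∫⁻ s in Ici (1 : ℝ), ‖gradient ψ (s • x)‖ₑ = ∫⁻ s in Ici (1 : ℝ), (f * g) s := by
      refine setLIntegral_congr_fun measurableSet_Ici fun s hs => ?_
      have hs0 : (0 : ℝ) < s := lt_of_lt_of_le one_pos hs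
      simp only [Pi.mul_apply, f, g]
      rw [← mul_assoc, ← ENNReal.ofReal_mul (by positivity), ← Real.rpow_add hs0]
      simp
    have h2 := ENNReal.lintegral_mul_le_Lp_mul_Lq (volume.restrict (Ici (1 : ℝ))) hconj
      (f := f) (g := g) (by fun_prop) (by
        have : Measurable fun s : ℝ => ENNReal.ofReal (s ^ (b / p)) := by fun_prop
        exact (this.mul hgx.enorm).aemeasurable)
    have h3 : ∫⁻ s in Ici (1 : ℝ), f s ^ p.conjExponent = A₁ := by
      refine setLIntegral_congr_fun measurableSet_Ici fun s hs => ?_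
      have hs0 : (0 : ℝ) < s := lt_of_lt_of_le one_pos hs
      simp only [f]
      rw [ENNReal.ofReal_rpow_of_nonneg (by positivity) (by rw [hp']; positivity),
        ← Real.rpow_mul hs0.le, hp']
      congr 2
      field_simp
    have h4 : ∫⁻ s in Ici (1 : ℝ), g s ^ p = ∫⁻ s in Ici (1 : ℝ), W s x := by
      refine setLIntegral_congr_fun measurableSet_Ici fun s hs => ?_
      have hs0 : (0 : ℝ) < s := lt_of_lt_of_le one_pos hs
      simp only [g, W]
      rw [ENNReal.mul_rpow_of_nonneg _ _ hp0.le,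
        ENNReal.ofReal_rpow_of_nonneg (by positivity) hp0.le, ← Real.rpow_mul hs0.le,
        div_mul_cancel₀ _ hp0.ne']
    rw [h3, h4] at h2
    calc ‖ψ x‖ₑ ^ p ≤ (∫⁻ s in Ici (1 : ℝ), ‖x‖ₑ * ‖gradient ψ (s • x)‖ₑ) ^ p := by
          gcongr; exact enorm_le_lintegral_ray hψ hc hx0
      _ = (‖x‖ₑ * ∫⁻ s in Ici (1 : ℝ), ‖gradient ψ (s • x)‖ₑ) ^ p := by
          rw [lintegral_const_mul _ hgx.enorm]
      _ ≤ (ENNReal.ofReal R' * (A₁ ^ (1 / p.conjExponent) *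
            (∫⁻ s in Ici (1 : ℝ), W s x) ^ (1 / p))) ^ p := by
          rw [h1]; gcongr
      _ = _ := by
          rw [ENNReal.mul_rpow_of_nonneg _ _ hp0.le, ENNReal.mul_rpow_of_nonneg _ _ hp0.le,
            ← ENNReal.rpow_mul, ← ENNReal.rpow_mul, one_div_mul_cancel hp0.ne', ENNReal.rpow_one]
          have : 1 / p.conjExponent * p = p - 1 := by rw [hp']; field_simp
          rw [this]; ring
  calc ∫⁻ x in S, ‖ψ x‖ₑ ^ p
      ≤ ∫⁻ x in S, A₁ ^ (p - 1) * (ENNReal.ofReal R' ^ p * ∫⁻ s in Ici (1 : ℝ), W s x) :=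
        setLIntegral_mono' hSm hpt
    _ = A₁ ^ (p - 1) * (ENNReal.ofReal R' ^ p * ∫⁻ x in S, ∫⁻ s in Ici (1 : ℝ), W s x) := by
        rw [lintegral_const_mul' _ _ (ENNReal.rpow_ne_top_of_nonneg hp1.le hA₁f),
          lintegral_const_mul' _ _ (ENNReal.rpow_ne_top_of_nonneg hp0.le ENNReal.ofReal_ne_top)]
    _ = A₁ ^ (p - 1) * (ENNReal.ofReal R' ^ p * ∫⁻ s in Ici (1 : ℝ), ∫⁻ x in S, W s x) := by
        rw [lintegral_lintegral_swap]
        exact (hWm.comp measurable_swap).aemeasurable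
    _ ≤ A₁ ^ (p - 1) * (ENNReal.ofReal R' ^ p * ∫⁻ s in Ici (1 : ℝ), ENNReal.ofReal (s ^ (b - N)) *
          ∫⁻ x in exteriorBall N R, ‖gradient ψ x‖ₑ ^ p) := by
        refine mul_le_mul_right (mul_le_mul_right (setLIntegral_mono' measurableSet_Ici
          fun s hs => ?_) _) _
        have hs0 : (0 : ℝ) < s := lt_of_lt_of_le one_pos hs
        calc ∫⁻ x in S, W s x ≤ ∫⁻ x in exteriorBall N R, W s x :=
              lintegral_mono_set inter_subset_left
          _ = ENNReal.ofReal (s ^ b) * ∫⁻ x in exteriorBall N R, ‖gradient ψ (s • x)‖ₑ ^ p :=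
              lintegral_const_mul' _ _ ENNReal.ofReal_ne_top
          _ ≤ ENNReal.ofReal (s ^ b) * (ENNReal.ofReal (s ^ (-(N : ℝ))) *
                ∫⁻ x in exteriorBall N R, ‖gradient ψ x‖ₑ ^ p) := by
              gcongr
              exact lintegral_exteriorBall_comp_smul_le (F := fun x => ‖gradient ψ x‖ₑ ^ p) hR hs
                (hgc.measurable.enorm.pow_const p)
          _ = _ := by
              rw [← mul_assoc, ← ENNReal.ofReal_mul (by positivity), ← Real.rpow_add hs0,
                sub_eq_add_neg]
    _ = _ := by
        rw [lintegral_mul_const _ (by fun_prop)]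
        ring

theorem hasGradientAt_of_contDiff {N : ℕ} {f : EuclideanSpace ℝ (Fin N) → ℝ} (hf : ContDiff ℝ 1 f)
    (x : EuclideanSpace ℝ (Fin N)) : HasGradientAt f (gradient f x) x :=
  (hf.differentiable one_ne_zero x).hasGradientAt

theorem hasGradientAt_mul {N : ℕ} {f g : EuclideanSpace ℝ (Fin N) → ℝ}
    {f' g' x : EuclideanSpace ℝ (Fin N)} (hf : HasGradientAt f f' x) (hg : HasGradientAt g g' x) :
    HasGradientAt (fun y => f y * g y) (f x • g' + g x • f') x := by
  rw [hasGradientAt_iff_hasFDerivAt] at *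
  refine (hf.mul hg).congr_fderiv ?_
  ext v
  simp

theorem hasGradientAt_comp {N : ℕ} {F : ℝ → ℝ} {F' : ℝ} {f : EuclideanSpace ℝ (Fin N) → ℝ}
    {f' x : EuclideanSpace ℝ (Fin N)} (hF : HasDerivAt F F' (f x)) (hf : HasGradientAt f f' x) :
    HasGradientAt (fun y => F (f y)) (F' • f') x := by
  rw [hasGradientAt_iff_hasFDerivAt] at *
  refine (hF.comp_hasFDerivAt x hf).congr_fderiv ?_
  ext v
  simp

/-- The Sobolev conjugate exponent `N p / (N - p)` of `p < N`. -/
noncomputable def sobolevExp (N : ℕ) (p : ℝ) : ℝ := N * p / (N - p)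

theorem exists_sobolev_constant {N : ℕ} {p : ℝ} (hp : 1 < p) (hpN : p < N) :
    ∃ C : ℝ≥0∞, C ≠ ∞ ∧ ∀ w : EuclideanSpace ℝ (Fin N) → ℝ, ContDiff ℝ 1 w → HasCompactSupport w →
      eLpNorm w (ENNReal.ofReal (sobolevExp N p)) volume ^ p ≤ C * ∫⁻ x, ‖gradient w x‖ₑ ^ p := by
  have hp0 : 0 < p := by linarith
  have hN : (0 : ℝ) < N := by linarith
  have hps : 0 ≤ sobolevExp N p := div_nonneg (by positivity) (by linarith)
  set pn : NNReal := p.toNNReal with hpn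
  have hpnc : (pn : ℝ) = p := Real.coe_toNNReal _ hp0.le
  refine ⟨(SNormLESNormFDerivOfEqConst ℝ (volume : Measure (EuclideanSpace ℝ (Fin N))) pn
    : ℝ≥0∞) ^ p, ENNReal.rpow_ne_top_of_nonneg hp0.le ENNReal.coe_ne_top, fun w hw hc => ?_⟩
  have h := eLpNorm_le_eLpNorm_fderiv_of_eq (volume : Measure (EuclideanSpace ℝ (Fin N))) hw hc
    (p := pn) (p' := (sobolevExp N p).toNNReal) (by rw [← NNReal.coe_le_coe, hpnc]; simpa using hp.le)
    (by rw [finrank_euclideanSpace_fin]; exact_mod_cast hN)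
    (by
      rw [finrank_euclideanSpace_fin, NNReal.coe_inv, hpnc, Real.coe_toNNReal _ hps, sobolevExp]
      field_simp)
  calc _ ≤ _ := ENNReal.rpow_le_rpow h hp0.le
    _ = _ := by
      rw [ENNReal.mul_rpow_of_nonneg _ _ hp0.le, eLpNorm_eq_lintegral_rpow_enorm_toReal
        (by simpa [hpn] using hp0) ENNReal.coe_ne_top, ← ENNReal.rpow_mul, ENNReal.coe_toReal, hpnc,
        one_div_mul_cancel hp0.ne', ENNReal.rpow_one]
      simp only [enorm_gradient]

/-- Sobolev's inequality in the exterior of a ball, for functions that need not vanish on its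
boundary. -/
theorem exists_exterior_sobolev_constant {N : ℕ} {p R R' : ℝ} (hp : 1 < p) (hpN : p < N)
    (hR : 0 < R) (hRR : R < R') :
    ∃ C : ℝ≥0∞, C ≠ ∞ ∧ ∀ ψ : EuclideanSpace ℝ (Fin N) → ℝ, ContDiff ℝ 1 ψ → HasCompactSupport ψ →
      eLpNorm ψ (ENNReal.ofReal (sobolevExp N p)) (volume.restrict (exteriorBall N R')) ^ p ≤
        C * ∫⁻ x in exteriorBall N R, ‖gradient ψ x‖ₑ ^ p := by
  have hp0 : 0 < p := by linarith
  obtain ⟨D, hD0, hD⟩ := exists_cutoff N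
  obtain ⟨C₁, hC₁, hH⟩ := exists_hardy_constant R' hp hpN hR
  obtain ⟨C₂, hC₂, hS⟩ := exists_sobolev_constant hp hpN
  set s := (R + R') / 2 with hs
  have hRs : R < s := by rw [hs]; linarith
  have hsR : s < R' := by rw [hs]; linarith
  -- Sobolev's inequality is applied to `(1 - η) * ψ`, and the term with `∇η` lives in an annulus
  obtain ⟨η, hη, h0, h1, hin, hout, hg, hgout⟩ := hD 0 s R' (by linarith) hsR
  set T : ℝ≥0∞ := ENNReal.ofReal (D / (R' - s)) with hT
  refine ⟨C₂ * (2 ^ (p - 1) * (1 + T ^ p * C₁)), ?_, fun ψ hψ hc => ?_⟩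
  · have : T ^ p ≠ ∞ := ENNReal.rpow_ne_top_of_nonneg hp0.le ENNReal.ofReal_ne_top
    have h2 : (2 : ℝ≥0∞) ^ (p - 1) ≠ ∞ :=
      ENNReal.rpow_ne_top_of_nonneg (by linarith) (by simp)
    exact ENNReal.mul_ne_top hC₂ (ENNReal.mul_ne_top h2
      (ENNReal.add_ne_top.2 ⟨by simp, ENNReal.mul_ne_top this hC₁⟩))
  set w : EuclideanSpace ℝ (Fin N) → ℝ := fun x => (1 - η x) * ψ x with hw
  have hθ : ContDiff ℝ 1 fun x => 1 - η x := contDiff_const.sub hη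
  have hwd : ContDiff ℝ 1 w := hθ.mul hψ
  have hwc : HasCompactSupport w := hc.mul_left
  have hgw : ∀ x, gradient w x = (1 - η x) • gradient ψ x + ψ x • (-gradient η x) := by
    intro x
    have h2 : HasGradientAt (fun x => 1 - η x) (-gradient η x) x := by
      have := hasGradientAt_comp (F := fun t => 1 - t) (F' := -1)
        ((hasDerivAt_id _).const_sub 1) (hasGradientAt_of_contDiff hη x)
      simpa using this
    exact (hasGradientAt_mul h2 (hasGradientAt_of_contDiff hψ x)).gradient
  have hgw0 : ∀ x ∉ exteriorBall N R, gradient w x = 0 := by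
    intro x hx
    have hx' : ‖x‖ ≤ R := by simpa [exteriorBall] using hx
    have : w =ᶠ[𝓝 x] fun _ => 0 := by
      filter_upwards [Metric.isOpen_ball.mem_nhds
        (show x ∈ Metric.ball (0 : EuclideanSpace ℝ (Fin N)) s by simp; linarith)] with y hy
      simp [hw, hin y (Metric.ball_subset_closedBall hy)]
    rw [this.gradient_eq, gradient_fun_const]
  have hgle : ∀ x, ‖gradient w x‖ₑ ^ p ≤ 2 ^ (p - 1) * (‖gradient ψ x‖ₑ ^ p +
      (Metric.closedBall 0 R').indicator (fun x => T ^ p * ‖ψ x‖ₑ ^ p) x) := by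
    intro x
    have h2 : ‖gradient w x‖ₑ ≤ ‖gradient ψ x‖ₑ +
        (Metric.closedBall 0 R').indicator (fun x => T * ‖ψ x‖ₑ) x := by
      rw [hgw]
      refine (enorm_add_le _ _).trans (add_le_add ?_ ?_)
      · rw [enorm_smul]
        refine mul_le_of_le_one_left zero_le ?_
        rw [← ofReal_norm, Real.norm_of_nonneg (by linarith [h1 x]), ENNReal.ofReal_le_one]
        linarith [h0 x]
      · by_cases hx : x ∈ Metric.ball (0 : EuclideanSpace ℝ (Fin N)) R'
        · rw [indicator_of_mem (Metric.ball_subset_closedBall hx), enorm_smul, enorm_neg, mul_comm]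
          gcongr
          rw [← ofReal_norm]
          exact ENNReal.ofReal_le_ofReal (hg x)
        · simp [hgout x hx]
    calc _ ≤ _ := ENNReal.rpow_le_rpow h2 hp0.le
      _ ≤ _ := ENNReal.rpow_add_le_mul_rpow_add_rpow _ _ hp.le
      _ = _ := by
        congr 2
        by_cases hx : x ∈ Metric.closedBall (0 : EuclideanSpace ℝ (Fin N)) R'
        · simp only [indicator_of_mem hx, ENNReal.mul_rpow_of_nonneg _ _ hp0.le]
        · simp only [indicator_of_notMem hx, ENNReal.zero_rpow_of_pos hp0]
  have hψm : Measurable fun x => ‖ψ x‖ₑ ^ p := hψ.continuous.measurable.enorm.pow_const p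
  have hgm : Measurable fun x => ‖gradient ψ x‖ₑ ^ p :=
    (continuous_gradient hψ).measurable.enorm.pow_const p
  have e1 : eLpNorm ψ (ENNReal.ofReal (sobolevExp N p)) (volume.restrict (exteriorBall N R')) ≤
      eLpNorm w (ENNReal.ofReal (sobolevExp N p)) volume := by
    rw [eLpNorm_congr_ae (g := w)]
    · exact eLpNorm_mono_measure _ Measure.restrict_le_self
    · filter_upwards [ae_restrict_mem (measurableSet_exteriorBall N R')] with x hx
      have : x ∉ Metric.ball (0 : EuclideanSpace ℝ (Fin N)) R' := by
        simp only [exteriorBall, mem_ofPred_eq] at hx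
        simpa using hx.le
      simp [hw, hout x this]
  have e2 : ∫⁻ x, ‖gradient w x‖ₑ ^ p = ∫⁻ x in exteriorBall N R, ‖gradient w x‖ₑ ^ p := by
    rw [← lintegral_indicator (measurableSet_exteriorBall N R)]
    congr 1
    ext x
    by_cases hx : x ∈ exteriorBall N R
    · rw [indicator_of_mem hx]
    · rw [indicator_of_notMem hx, hgw0 x hx, enorm_zero, ENNReal.zero_rpow_of_pos hp0]
  calc _ ≤ eLpNorm w (ENNReal.ofReal (sobolevExp N p)) volume ^ p :=
        ENNReal.rpow_le_rpow e1 hp0.le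
    _ ≤ C₂ * ∫⁻ x in exteriorBall N R, ‖gradient w x‖ₑ ^ p := by
        rw [← e2]; exact hS w hwd hwc
    _ ≤ C₂ * ∫⁻ x in exteriorBall N R, 2 ^ (p - 1) * (‖gradient ψ x‖ₑ ^ p +
          (Metric.closedBall 0 R').indicator (fun x => T ^ p * ‖ψ x‖ₑ ^ p) x) := by
        gcongr with x
        exact hgle x
    _ = C₂ * (2 ^ (p - 1) * ((∫⁻ x in exteriorBall N R, ‖gradient ψ x‖ₑ ^ p) +
          T ^ p * ∫⁻ x in exteriorBall N R ∩ Metric.closedBall 0 R', ‖ψ x‖ₑ ^ p)) := by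
        rw [lintegral_const_mul' _ _ (ENNReal.rpow_ne_top_of_nonneg (by linarith) (by simp)),
          lintegral_add_left hgm, lintegral_indicator measurableSet_closedBall,
          Measure.restrict_restrict measurableSet_closedBall, inter_comm,
          lintegral_const_mul _ hψm]
    _ ≤ C₂ * (2 ^ (p - 1) * ((∫⁻ x in exteriorBall N R, ‖gradient ψ x‖ₑ ^ p) +
          T ^ p * (C₁ * ∫⁻ x in exteriorBall N R, ‖gradient ψ x‖ₑ ^ p))) := by
        gcongr
        exact hH ψ hψ hc
    _ = _ := by ring

/-! ### Test functions and the energy inequality -/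

theorem ofReal_norm_rpow {V : Type*} [NormedAddCommGroup V] {p : ℝ} (hp : 0 ≤ p) (z : V) :
    ENNReal.ofReal (‖z‖ ^ p) = ‖z‖ₑ ^ p := by
  rw [← ENNReal.ofReal_rpow_of_nonneg (norm_nonneg _) hp, ofReal_norm]

/-- Hölder's inequality for the measure with density `W`, and exponents `p / (p - 1)` and `p`. -/
theorem lintegral_weighted_holder {α : Type*} [MeasurableSpace α] {μ : Measure α} {p : ℝ}
    (hp : 1 < p) {W a b : α → ℝ≥0∞} (hW : AEMeasurable W μ) (ha : AEMeasurable a μ)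
    (hb : AEMeasurable b μ) :
    ∫⁻ x, W x * (a x ^ (p - 1) * b x) ∂μ ≤
      (∫⁻ x, W x * a x ^ p ∂μ) ^ ((p - 1) / p) * (∫⁻ x, W x * b x ^ p ∂μ) ^ (1 / p) := by
  have hp0 : 0 < p := by linarith
  have hp1 : 0 < p - 1 := by linarith
  have hconj : p.conjExponent.HolderConjugate p := (Real.HolderConjugate.conjExponent hp).symm
  have hp' : p.conjExponent = p / (p - 1) := rfl
  have h := ENNReal.lintegral_mul_le_Lp_mul_Lq μ hconj
    (f := fun x => W x ^ ((p - 1) / p) * a x ^ (p - 1)) (g := fun x => W x ^ (1 / p) * b x)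
    ((hW.pow_const _).mul (ha.pow_const _)) ((hW.pow_const _).mul hb)
  have e1 : ∀ x, W x * (a x ^ (p - 1) * b x) =
      ((fun x => W x ^ ((p - 1) / p) * a x ^ (p - 1)) * fun x => W x ^ (1 / p) * b x) x := by
    intro x
    simp only [Pi.mul_apply]
    rw [mul_mul_mul_comm, ← ENNReal.rpow_add_of_nonneg _ _ (by positivity) (by positivity),
      ← add_div, sub_add_cancel, div_self hp0.ne', ENNReal.rpow_one]
  have e2 : ∀ x, (W x ^ ((p - 1) / p) * a x ^ (p - 1)) ^ p.conjExponent = W x * a x ^ p := by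
    intro x
    rw [hp', ENNReal.mul_rpow_of_nonneg _ _ (by positivity), ← ENNReal.rpow_mul, ← ENNReal.rpow_mul,
      div_mul_div_cancel₀ hp0.ne', div_self hp1.ne', ENNReal.rpow_one, mul_div_cancel₀ _ hp1.ne']
  have e3 : ∀ x, (W x ^ (1 / p) * b x) ^ p = W x * b x ^ p := by
    intro x
    rw [ENNReal.mul_rpow_of_nonneg _ _ hp0.le, ← ENNReal.rpow_mul, one_div_mul_cancel hp0.ne',
      ENNReal.rpow_one]
  simp only [← e1, e2, e3] at h
  rwa [show 1 / p.conjExponent = (p - 1) / p by rw [hp', one_div_div]] at h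

/-- Passage from an inequality with a signed term `F`, a Bochner integral, to lower integrals. -/
theorem lintegral_ofReal_le_of_le_add {α : Type*} [MeasurableSpace α] {μ : Measure α}
    {F X Y : α → ℝ} (hF : Integrable F μ) (hY : AEMeasurable Y μ) (hY0 : ∀ᵐ x ∂μ, 0 ≤ Y x)
    (hX0 : ∀ᵐ x ∂μ, 0 ≤ X x) (h : ∀ᵐ x ∂μ, X x ≤ F x + Y x) :
    ∫⁻ x, ENNReal.ofReal (X x) ∂μ ≤
      ENNReal.ofReal (∫ x, F x ∂μ) + ∫⁻ x, ENNReal.ofReal (Y x) ∂μ := by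
  by_cases htop : ∫⁻ x, ENNReal.ofReal (Y x) ∂μ = ∞
  · simp [htop]
  have hYi : Integrable Y μ :=
    (lintegral_ofReal_ne_top_iff_integrable hY.aestronglyMeasurable hY0).1 htop
  calc ∫⁻ x, ENNReal.ofReal (X x) ∂μ ≤ ∫⁻ x, ENNReal.ofReal (F x + Y x) ∂μ := by
        refine lintegral_mono_ae ?_
        filter_upwards [h] with x hx using ENNReal.ofReal_le_ofReal hx
    _ = ENNReal.ofReal (∫ x, F x + Y x ∂μ) := by
        rw [ofReal_integral_eq_lintegral_ofReal (f := fun x => F x + Y x) (hF.add hYi)]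
        filter_upwards [h, hX0] with x hx hx0 using hx0.trans hx
    _ ≤ _ := by
        rw [integral_add hF hYi, ← ofReal_integral_eq_lintegral_ofReal hYi hY0]
        exact ENNReal.ofReal_add_le

section TestFunctions

variable {N : ℕ} {Ω : Set (EuclideanSpace ℝ (Fin N))}

theorem gradient_eq_zero_of_notMem_tsupport {ψ : EuclideanSpace ℝ (Fin N) → ℝ}
    {x : EuclideanSpace ℝ (Fin N)} (hx : x ∉ tsupport ψ) : gradient ψ x = 0 := by
  have : ψ =ᶠ[𝓝 x] fun _ => 0 := notMem_tsupport_iff_eventuallyEq.1 hx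
  rw [this.gradient_eq, gradient_fun_const]

theorem integral_smul_gradient {φ ψ : EuclideanSpace ℝ (Fin N) → ℝ} (hφ : ContDiff ℝ 1 φ)
    (hφc : HasCompactSupport φ) (hψ : ContDiff ℝ 1 ψ) (hψc : HasCompactSupport ψ) :
    ∫ x, ψ x • gradient φ x = - ∫ x, φ x • gradient ψ x := by
  have i1 : Integrable fun x => ψ x • gradient φ x :=
    (hψ.continuous.smul (continuous_gradient hφ)).integrable_of_hasCompactSupport hψc.smul_right
  have i2 : Integrable fun x => φ x • gradient ψ x :=
    (hφ.continuous.smul (continuous_gradient hψ)).integrable_of_hasCompactSupport hφc.smul_right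
  refine ext_inner_right ℝ fun v => ?_
  rw [inner_neg_left, real_inner_comm, real_inner_comm v, ← integral_inner i1, ← integral_inner i2]
  have e : ∀ f g : EuclideanSpace ℝ (Fin N) → ℝ, ∀ x,
      inner ℝ v (f x • gradient g x) = f x * fderiv ℝ g x v := by
    intro f g x
    rw [inner_smul_right, real_inner_comm, inner_gradient_left]
  simp only [e]
  have hf : ∀ {f : EuclideanSpace ℝ (Fin N) → ℝ}, ContDiff ℝ 1 f →
      Continuous fun x => fderiv ℝ f x v := fun h =>
    (h.continuous_fderiv one_ne_zero).clm_apply continuous_const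
  rw [integral_mul_fderiv_eq_neg_fderiv_mul_of_integrable]
  · simp only [mul_comm]
  · exact ((hf hψ).mul hφ.continuous).integrable_of_hasCompactSupport hφc.mul_left
  · exact (hψ.continuous.mul (hf hφ)).integrable_of_hasCompactSupport hψc.mul_right
  · exact (hψ.continuous.mul hφ.continuous).integrable_of_hasCompactSupport hψc.mul_right
  · exact fun x _ => hψ.differentiable one_ne_zero x
  · exact fun x _ => hφ.differentiable one_ne_zero x

/-- Functions of class `C_c^1` are admissible in the weak formulation. -/
theorem memD0_of_isTest {p : ℝ} (hp : 0 < p) (L : EuclideanSpace ℝ (Fin N) → ℝ)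
    {ψ : EuclideanSpace ℝ (Fin N) → ℝ} (hψ : IsTest 1 Ω ψ) : MemD0 p Ω L ψ (gradient ψ) := by
  obtain ⟨h1, h2, h3⟩ := hψ
  have h1' : ContDiff ℝ 1 ψ := h1
  refine ⟨⟨h1'.continuous.locallyIntegrable.locallyIntegrableOn _,
    (continuous_gradient h1').locallyIntegrable.locallyIntegrableOn _, fun φ hφ => ?_⟩,
    fun _ => ψ, fun _ => ⟨h1, h2, h3⟩, ?_, fun C _ _ => ?_⟩
  · have hφ1 : ContDiff ℝ 1 φ := hφ.1.of_le (by exact_mod_cast le_top)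
    rw [setIntegral_eq_integral_of_forall_compl_eq_zero, setIntegral_eq_integral_of_forall_compl_eq_zero]
    · exact integral_smul_gradient hφ1 hφ.2.1 h1' h2
    · intro x hx
      rw [gradient_eq_zero_of_notMem_tsupport fun h => hx (h3 h), smul_zero]
    · intro x hx
      rw [image_eq_zero_of_notMem_tsupport fun h => hx (h3 h), zero_smul]
  · simp [Real.zero_rpow hp.ne']
  · simp

theorem lintegral_weight_gradient_lt_top {p : ℝ} (hp : 0 < p) {L : EuclideanSpace ℝ (Fin N) → ℝ}
    (hL : LocallyIntegrableOn L Ω volume) {ψ : EuclideanSpace ℝ (Fin N) → ℝ} (hψ : IsTest 1 Ω ψ) :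
    ∫⁻ x in Ω, ENNReal.ofReal (L x) * ‖gradient ψ x‖ₑ ^ p < ∞ := by
  obtain ⟨h1, h2, h3⟩ := hψ
  have h1' : ContDiff ℝ 1 ψ := h1
  have hgc := continuous_gradient h1'
  obtain ⟨M, hM⟩ := h2.isCompact.exists_bound_of_continuousOn hgc.continuousOn
  have hLi : IntegrableOn L (tsupport ψ) volume :=
    hL.integrableOn_compact_subset h3 h2.isCompact
  have hsm : MeasurableSet (tsupport ψ) := h2.isCompact.measurableSet
  calc ∫⁻ x in Ω, ENNReal.ofReal (L x) * ‖gradient ψ x‖ₑ ^ p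
      ≤ ∫⁻ x, (tsupport ψ).indicator
          (fun x => ENNReal.ofReal (L x) * ENNReal.ofReal M ^ p) x := by
        refine (setLIntegral_le_lintegral _ _).trans (lintegral_mono fun x => ?_)
        by_cases hx : x ∈ tsupport ψ
        · rw [indicator_of_mem hx, ← ofReal_norm]
          gcongr
          exact hM x hx
        · rw [gradient_eq_zero_of_notMem_tsupport hx, enorm_zero, ENNReal.zero_rpow_of_pos hp,
            mul_zero]
          exact zero_le
    _ = (∫⁻ x in tsupport ψ, ENNReal.ofReal (L x)) * ENNReal.ofReal M ^ p := by
        rw [lintegral_indicator hsm,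
          lintegral_mul_const' _ _ (ENNReal.rpow_ne_top_of_nonneg hp.le ENNReal.ofReal_ne_top)]
    _ < ∞ := ENNReal.mul_lt_top hLi.setLIntegral_lt_top
        (ENNReal.rpow_lt_top_of_nonneg hp.le ENNReal.ofReal_ne_top)

end TestFunctions

/-- The constant in the energy inequality. -/
noncomputable def energyConst (p : ℝ) : ℝ := 3 ^ p * (2 * (2 * p) ^ p + 2)

/-- The Caccioppoli inequality for a test function `φ`, obtained by inserting `η^p Φ(φ)` into the
equation for `u`. It is meaningful if `φ` is close to `u`, since its error terms contain
`∇φ - G`. -/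
theorem lintegral_energy_le {N : ℕ} {p lam h : ℝ} (hp : 1 < p) (hh : 0 ≤ h)
    {Ω : Set (EuclideanSpace ℝ (Fin N))}
    {L K u : EuclideanSpace ℝ (Fin N) → ℝ} {G : EuclideanSpace ℝ (Fin N) → EuclideanSpace ℝ (Fin N)}
    (hLm : AEMeasurable L (volume.restrict Ω)) (hL0 : ∀ᵐ x ∂(volume.restrict Ω), 0 < L x)
    (hLloc : LocallyIntegrableOn L Ω volume) (hG : AEStronglyMeasurable G (volume.restrict Ω))
    (hGfin : ∫⁻ x in Ω, ENNReal.ofReal (L x) * ‖G x‖ₑ ^ p ≠ ∞)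
    (heq : ∀ ψ, IsTest 1 Ω ψ → ∫ x in Ω, L x * (‖G x‖ ^ (p - 2) * inner ℝ (G x) (gradient ψ x)) =
      lam * ∫ x in Ω, K x * (|u x| ^ (p - 2) * u x * ψ x))
    {φ η : EuclideanSpace ℝ (Fin N) → ℝ} (hφ : IsTest 1 Ω φ) (hη : ContDiff ℝ 1 η)
    (hη0 : ∀ x, 0 ≤ η x) (hη1 : ∀ x, η x ≤ 1) {Φ Φ' : ℝ → ℝ} (hΦ : ∀ s, HasDerivAt Φ (Φ' s) s)
    (hΦc : Continuous Φ') (hΦ0 : ∀ s, 0 ≤ Φ s) (hΦ'0 : ∀ s, 0 ≤ Φ' s) (hΦ'1 : ∀ s, Φ' s ≤ 1)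
    (hΦle : ∀ s, Φ s ≤ max (s - h) 0 * Φ' s) :
    ∫⁻ x in Ω, ENNReal.ofReal (L x) * ‖gradient (fun y => η y * Φ (φ y)) x‖ₑ ^ p ≤
      ENNReal.ofReal (energyConst p) *
        (ENNReal.ofReal |lam| * (∫⁻ x in Ω, ‖K x‖ₑ * (‖u x‖ₑ ^ (p - 1) *
            ENNReal.ofReal (η x ^ p * Φ (φ x)))) +
          (∫⁻ x in Ω, ENNReal.ofReal (L x) * (‖G x‖ₑ ^ (p - 1) * ‖gradient φ x - G x‖ₑ)) +
          (∫⁻ x in Ω, ENNReal.ofReal (L x) * ‖gradient φ x - G x‖ₑ ^ p) +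
          ∫⁻ x in Ω, ENNReal.ofReal (L x) * (‖gradient η x‖ₑ ^ p *
            ENNReal.ofReal (max (φ x - h) 0) ^ p)) := by
  have hp0 : 0 < p := by linarith
  have hp1 : 0 < p - 1 := by linarith
  obtain ⟨hφd, hφc, hφΩ⟩ := hφ
  have hφd' : ContDiff ℝ 1 φ := hφd
  have hΦd : ContDiff ℝ 1 Φ := by
    rw [contDiff_one_iff_deriv]
    refine ⟨fun s => (hΦ s).differentiableAt, ?_⟩
    rwa [show deriv Φ = Φ' from funext fun s => (hΦ s).deriv]
  have hΦz : Φ 0 = 0 := le_antisymm (by simpa [hh] using hΦle 0) (hΦ0 0)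
  -- the power `p` of `η` gives the factor `η ^ (p - 1)` in the gradient that Young's inequality needs
  set ψ : EuclideanSpace ℝ (Fin N) → ℝ := fun y => η y ^ p * Φ (φ y) with hψ
  have hηp : ContDiff ℝ 1 fun y => η y ^ p := by
    have := ContDiff.rpow_const_of_le (m := 1) (f := η) (p := p) (by exact_mod_cast hη)
      (by exact_mod_cast hp.le)
    exact_mod_cast this
  have hψd : ContDiff ℝ 1 ψ := hηp.mul (hΦd.comp hφd')
  have hψs : tsupport ψ ⊆ tsupport φ := by
    refine closure_mono fun x hx => ?_
    contrapose! hx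
    simp only [Function.mem_support, not_not] at hx ⊢
    simp [hψ, hx, hΦz]
  have hψt : IsTest 1 Ω ψ :=
    ⟨hψd, hφc.of_isClosed_subset (isClosed_tsupport _) hψs, hψs.trans hφΩ⟩
  have hgψ : ∀ x, gradient ψ x =
      (η x ^ p * Φ' (φ x)) • gradient φ x + (p * η x ^ (p - 1) * Φ (φ x)) • gradient η x := by
    intro x
    have h1 := hasGradientAt_comp (F := fun t => t ^ p)
      (Real.hasDerivAt_rpow_const (x := η x) (p := p) (Or.inr hp.le)) (hasGradientAt_of_contDiff hη x)
    have h2 := hasGradientAt_comp (hΦ (φ x)) (hasGradientAt_of_contDiff hφd' x)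
    rw [(hasGradientAt_mul h1 h2).gradient, smul_smul, smul_smul]
    congr 2
    ring
  have hgw : ∀ x, gradient (fun y => η y * Φ (φ y)) x =
      (η x * Φ' (φ x)) • gradient φ x + Φ (φ x) • gradient η x := by
    intro x
    have h2 := hasGradientAt_comp (hΦ (φ x)) (hasGradientAt_of_contDiff hφd' x)
    rw [(hasGradientAt_mul (hasGradientAt_of_contDiff hη x) h2).gradient, smul_smul]
  -- the flux is integrable against the gradient of the test function
  set F : EuclideanSpace ℝ (Fin N) → ℝ :=
    fun x => L x * (‖G x‖ ^ (p - 2) * inner ℝ (G x) (gradient ψ x)) with hF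
  have hgφm : AEStronglyMeasurable (gradient φ) (volume.restrict Ω) :=
    (continuous_gradient hφd').aestronglyMeasurable
  have hgψm : AEStronglyMeasurable (gradient ψ) (volume.restrict Ω) :=
    (continuous_gradient hψd).aestronglyMeasurable
  have hFi : Integrable F (volume.restrict Ω) := by
    refine ⟨?_, ?_⟩
    · exact hLm.aestronglyMeasurable.mul
        ((hG.norm.aemeasurable.pow_const _).aestronglyMeasurable.mul (hG.inner hgψm))
    · calc ∫⁻ x in Ω, ‖F x‖ₑ
          ≤ ∫⁻ x in Ω, ENNReal.ofReal (L x) * (‖G x‖ₑ ^ (p - 1) * ‖gradient ψ x‖ₑ) := by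
            refine lintegral_mono_ae ?_
            filter_upwards [hL0] with x hx
            rw [← ofReal_norm_rpow hp1.le, ← ofReal_norm (gradient ψ x),
              ← ENNReal.ofReal_mul (by positivity), ← ENNReal.ofReal_mul hx.le, ← ofReal_norm]
            apply ENNReal.ofReal_le_ofReal
            rw [hF, norm_mul, Real.norm_of_nonneg hx.le]
            gcongr
            exact abs_flux_le hp _ _
        _ ≤ _ := lintegral_weighted_holder hp hLm.ennreal_ofReal hG.enorm hgψm.enorm
        _ < ∞ := ENNReal.mul_lt_top
            (ENNReal.rpow_lt_top_of_nonneg (by positivity) hGfin)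
            (ENNReal.rpow_lt_top_of_nonneg (by positivity)
              (lintegral_weight_gradient_lt_top hp0 hLloc hψt).ne)
  set c := energyConst p with hc
  have h3p : (0 : ℝ) < 3 ^ p := by positivity
  have h2p : (0 : ℝ) < (2 * p) ^ p := by positivity
  have hc0 : 0 ≤ c := by rw [hc, energyConst]; positivity
  set Y : EuclideanSpace ℝ (Fin N) → ℝ := fun x => c * (L x * (‖G x‖ ^ (p - 1) * ‖gradient φ x - G x‖)
    + L x * ‖gradient φ x - G x‖ ^ p
    + L x * (‖gradient η x‖ ^ p * max (φ x - h) 0 ^ p)) with hY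
  have key := lintegral_ofReal_le_of_le_add (μ := volume.restrict Ω) (F := fun x => 2 * 3 ^ p * F x)
    (X := fun x => L x * ‖gradient (fun y => η y * Φ (φ y)) x‖ ^ p) (Y := Y)
    (hFi.const_mul _) (by
      have hgη : AEMeasurable (gradient η) (volume.restrict Ω) :=
        (continuous_gradient hη).aemeasurable
      have hφm : AEMeasurable φ (volume.restrict Ω) := hφd'.continuous.aemeasurable
      have hd : AEMeasurable (fun x => ‖gradient φ x - G x‖) (volume.restrict Ω) :=
        (hgφm.sub hG).norm.aemeasurable
      exact ((((hLm.mul ((hG.norm.aemeasurable.pow_const _).mul hd)).add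
        (hLm.mul (hd.pow_const _))).add (hLm.mul ((hgη.norm.pow_const _).mul
          (((hφm.sub_const h).max aemeasurable_const).pow_const _))))).const_mul c)
    (by
      filter_upwards [hL0] with x hx
      positivity)
    (by
      filter_upwards [hL0] with x hx
      positivity)
    (by
      filter_upwards [hL0] with x hx
      have hpt := pointwise_energy hp (hη0 x) (hη1 x) (hΦ0 (φ x)) (le_max_right (φ x - h) 0)
        (hΦ'0 (φ x)) (hΦ'1 (φ x)) (hΦle (φ x)) (G x) (gradient φ x) (gradient η x)
      rw [← hgψ, ← hgw] at hpt
      have a1 : 0 ≤ ‖G x‖ ^ (p - 1) * ‖gradient φ x - G x‖ := by positivity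
      have a2 : 0 ≤ ‖gradient φ x - G x‖ ^ p := by positivity
      have a3 : 0 ≤ ‖gradient η x‖ ^ p * max (φ x - h) 0 ^ p := by positivity
      have hpt' : ‖gradient (fun y => η y * Φ (φ y)) x‖ ^ p ≤
          2 * 3 ^ p * (‖G x‖ ^ (p - 2) * inner ℝ (G x) (gradient ψ x)) +
          c * (‖G x‖ ^ (p - 1) * ‖gradient φ x - G x‖ + ‖gradient φ x - G x‖ ^ p +
            ‖gradient η x‖ ^ p * max (φ x - h) 0 ^ p) := by
        refine hpt.trans ?_
        have a4 := mul_nonneg h3p.le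
          (add_nonneg (add_nonneg (mul_nonneg h2p.le a1)
            (mul_nonneg h2p.le a2)) (add_nonneg (mul_nonneg h2p.le (add_nonneg a1 a2))
            (add_nonneg a2 a3)))
        rw [hc, energyConst]
        linear_combination a4
      calc _ ≤ L x * _ := mul_le_mul_of_nonneg_left hpt' hx.le
        _ = _ := by rw [hF, hY]; ring)
  have hXe : ∫⁻ x in Ω, ENNReal.ofReal (L x) * ‖gradient (fun y => η y * Φ (φ y)) x‖ₑ ^ p =
      ∫⁻ x in Ω, ENNReal.ofReal (L x * ‖gradient (fun y => η y * Φ (φ y)) x‖ ^ p) := by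
    refine lintegral_congr_ae ?_
    filter_upwards [hL0] with x hx
    rw [ENNReal.ofReal_mul hx.le, ofReal_norm_rpow hp0.le]
  have hFe : ENNReal.ofReal (∫ x in Ω, 2 * 3 ^ p * F x) ≤ ENNReal.ofReal c *
      (ENNReal.ofReal |lam| * ∫⁻ x in Ω, ‖K x‖ₑ * (‖u x‖ₑ ^ (p - 1) *
            ENNReal.ofReal (η x ^ p * Φ (φ x)))) := by
    rw [integral_const_mul, ENNReal.ofReal_mul (by positivity)]
    refine mul_le_mul' (ENNReal.ofReal_le_ofReal ?_) ?_
    · rw [hc, energyConst]; nlinarith [mul_pos h3p h2p]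
    rw [hF, heq ψ hψt]
    -- no integrability is needed: the Bochner integral is bounded by the lower integral anyway
    calc ENNReal.ofReal (lam * ∫ x in Ω, K x * (|u x| ^ (p - 2) * u x * ψ x))
        ≤ ‖lam * ∫ x in Ω, K x * (|u x| ^ (p - 2) * u x * ψ x)‖ₑ := by
          rw [← ofReal_norm]; exact ENNReal.ofReal_le_ofReal (le_abs_self _)
      _ = ENNReal.ofReal |lam| * ‖∫ x in Ω, K x * (|u x| ^ (p - 2) * u x * ψ x)‖ₑ := by
          rw [enorm_mul, ← ofReal_norm lam, Real.norm_eq_abs]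
      _ ≤ ENNReal.ofReal |lam| * ∫⁻ x in Ω, ‖K x * (|u x| ^ (p - 2) * u x * ψ x)‖ₑ := by
          gcongr
          exact enorm_integral_le_lintegral_enorm _
      _ = _ := by
          congr 2
          ext x
          have hψ0 : 0 ≤ ψ x := mul_nonneg (Real.rpow_nonneg (hη0 x) _) (hΦ0 _)
          rw [enorm_mul, enorm_mul, ← ofReal_norm (ψ x), Real.norm_of_nonneg hψ0,
            ← ofReal_norm_rpow hp1.le, ← ofReal_norm (_ * u x), norm_mul, Real.norm_of_nonneg
              (Real.rpow_nonneg (abs_nonneg _) _), ← Real.norm_eq_abs,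
            norm_rpow_sub_two_mul_norm hp]
  have hYe : ∫⁻ x in Ω, ENNReal.ofReal (Y x) = ENNReal.ofReal c * (
      (∫⁻ x in Ω, ENNReal.ofReal (L x) * (‖G x‖ₑ ^ (p - 1) * ‖gradient φ x - G x‖ₑ)) +
          (∫⁻ x in Ω, ENNReal.ofReal (L x) * ‖gradient φ x - G x‖ₑ ^ p) +
          ∫⁻ x in Ω, ENNReal.ofReal (L x) * (‖gradient η x‖ₑ ^ p *
            ENNReal.ofReal (max (φ x - h) 0) ^ p)) := by
    have hd : AEMeasurable (fun x => ‖gradient φ x - G x‖ₑ) (volume.restrict Ω) :=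
      (hgφm.sub hG).enorm
    have m1 : AEMeasurable (fun x => ENNReal.ofReal (L x) *
        (‖G x‖ₑ ^ (p - 1) * ‖gradient φ x - G x‖ₑ)) (volume.restrict Ω) :=
      hLm.ennreal_ofReal.mul ((hG.enorm.pow_const _).mul hd)
    have m2 : AEMeasurable (fun x => ENNReal.ofReal (L x) * ‖gradient φ x - G x‖ₑ ^ p)
        (volume.restrict Ω) := hLm.ennreal_ofReal.mul (hd.pow_const _)
    have m3 : AEMeasurable (fun x => ENNReal.ofReal (L x) * (‖gradient η x‖ₑ ^ p *
        ENNReal.ofReal (max (φ x - h) 0) ^ p)) (volume.restrict Ω) := by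
      have hgη : AEMeasurable (gradient η) (volume.restrict Ω) :=
        (continuous_gradient hη).aemeasurable
      have hφm : AEMeasurable φ (volume.restrict Ω) := hφd'.continuous.aemeasurable
      exact hLm.ennreal_ofReal.mul ((hgη.enorm.pow_const _).mul
        (((hφm.sub_const h).max aemeasurable_const).ennreal_ofReal.pow_const _))
    rw [← lintegral_add_left' m1, ← lintegral_add_right' _ m3,
      ← lintegral_const_mul' _ _ ENNReal.ofReal_ne_top]
    refine lintegral_congr_ae ?_
    filter_upwards [hL0] with x hx
    rw [hY]
    simp only
    have a0 : 0 ≤ max (φ x - h) 0 := le_max_right _ _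
    rw [ENNReal.ofReal_mul hc0, ENNReal.ofReal_add (by positivity) (by positivity),
      ENNReal.ofReal_add (by positivity) (by positivity), ENNReal.ofReal_mul hx.le,
      ENNReal.ofReal_mul hx.le, ENNReal.ofReal_mul hx.le, ENNReal.ofReal_mul (by positivity),
      ENNReal.ofReal_mul (by positivity), ofReal_norm_rpow hp1.le, ofReal_norm_rpow hp0.le,
      ofReal_norm_rpow hp0.le, ofReal_norm, ENNReal.ofReal_rpow_of_nonneg a0 hp0.le]
  rw [hXe]
  calc _ ≤ _ := key
    _ ≤ _ := add_le_add hFe hYe.le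
    _ = _ := by ring

/-! ### Solutions with an approximating sequence -/

/-- Hölder's inequality with the exponents `q / (q - p)` and `q / p`. For `q = p` the first of them
is `∞`. -/
theorem lintegral_mul_rpow_le_eLpNorm {α : Type*} [MeasurableSpace α] {ν : Measure α} {p q : ℝ}
    (hp : 0 < p) (hpq : p ≤ q) {W f : α → ℝ} (hW : AEStronglyMeasurable W ν)
    (hf : AEStronglyMeasurable f ν) :
    ∫⁻ x, ‖W x‖ₑ * ‖f x‖ₑ ^ p ∂ν ≤
      eLpNorm W (weightExponent p q) ν * eLpNorm f (ENNReal.ofReal q) ν ^ p := by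
  have hq : 0 < q := hp.trans_le hpq
  have hT : (weightExponent p q).HolderTriple (ENNReal.ofReal (q / p)) 1 := by
    refine ⟨?_⟩
    rw [weightExponent, ENNReal.inv_div (Or.inl ENNReal.ofReal_ne_top)
      (Or.inr (by simpa using hq)), ← ENNReal.ofReal_div_of_pos hq,
      ← ENNReal.ofReal_inv_of_pos (by positivity), inv_div,
      ← ENNReal.ofReal_add (div_nonneg (by linarith) hq.le) (by positivity), ← add_div,
      sub_add_cancel, div_self hq.ne']
    simp
  have h := eLpNorm_smul_le_mul_eLpNorm (μ := ν) (p := weightExponent p q)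
    (q := ENNReal.ofReal (q / p)) (r := 1) (f := fun x => ‖f x‖ ^ p)
    (hf.norm.aemeasurable.pow_const p).aestronglyMeasurable (φ := W) hW
  rw [eLpNorm_norm_rpow f hp, ← ENNReal.ofReal_mul (by positivity), div_mul_cancel₀ _ hp.ne',
    eLpNorm_one_eq_lintegral_enorm] at h
  refine le_trans (le_of_eq (lintegral_congr fun x => ?_)) h
  rw [Pi.smul_apply', smul_eq_mul, enorm_mul, ← ofReal_norm_rpow hp.le,
    Real.enorm_eq_ofReal (Real.rpow_nonneg (norm_nonneg _) _)]

/-- A weak solution `u` with weak gradient `G`, together with a sequence `φ` of test functions that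
approximates it. The equation is only required for test functions of class `C^1`. -/
structure ApproxSolution {N : ℕ} (p R₁ : ℝ) (L K : EuclideanSpace ℝ (Fin N) → ℝ) (lam : ℝ)
    (u : EuclideanSpace ℝ (Fin N) → ℝ) (G : EuclideanSpace ℝ (Fin N) → EuclideanSpace ℝ (Fin N))
    (φ : ℕ → EuclideanSpace ℝ (Fin N) → ℝ) : Prop where
  aemeasurable_L : AEMeasurable L (volume.restrict (exteriorBall N R₁))
  aemeasurable_K : AEMeasurable K (volume.restrict (exteriorBall N R₁))
  pos_L : ∀ᵐ x ∂(volume.restrict (exteriorBall N R₁)), 0 < L x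
  locallyIntegrable_L : LocallyIntegrableOn L (exteriorBall N R₁) volume
  meas_u : AEStronglyMeasurable u (volume.restrict (exteriorBall N R₁))
  meas_G : AEStronglyMeasurable G (volume.restrict (exteriorBall N R₁))
  isTest : ∀ n, IsTest 1 (exteriorBall N R₁) (φ n)
  tendsto_gradient : Tendsto (fun n => ∫⁻ x in exteriorBall N R₁,
    ENNReal.ofReal (L x) * ‖gradient (φ n) x - G x‖ₑ ^ p) atTop (𝓝 0)
  tendsto_local : ∀ C : Set (EuclideanSpace ℝ (Fin N)), IsCompact C → C ⊆ exteriorBall N R₁ →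
    Tendsto (fun n => ∫⁻ x in C, ENNReal.ofReal |φ n x - u x|) atTop (𝓝 0)
  equation : ∀ ψ, IsTest 1 (exteriorBall N R₁) ψ →
    ∫ x in exteriorBall N R₁, L x * (‖G x‖ ^ (p - 2) * inner ℝ (G x) (gradient ψ x)) =
      lam * ∫ x in exteriorBall N R₁, K x * (|u x| ^ (p - 2) * u x * ψ x)

theorem IsWeakSolution.exists_approxSolution {N : ℕ} {p R₁ lam : ℝ} (hp : 1 < p)
    {L K u : EuclideanSpace ℝ (Fin N) → ℝ} (hLK : StandingWeights N R₁ L K)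
    (hu : IsWeakSolution p (exteriorBall N R₁) L K lam u) :
    ∃ G φ, ApproxSolution p R₁ L K lam u G φ := by
  obtain ⟨G, ⟨⟨hu1, hG1, -⟩, φ, hφ, hφG, hφu⟩, heq⟩ := hu
  refine ⟨G, φ, hLK.measurable_L, hLK.measurable_K, hLK.pos_L, hLK.locallyIntegrable_L,
    hu1.aestronglyMeasurable, hG1.aestronglyMeasurable, hφ, ?_, hφu,
    fun ψ hψ => heq ψ (gradient ψ) (memD0_of_isTest (by linarith) L hψ)⟩
  refine hφG.congr fun n => lintegral_congr fun x => ?_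
  rw [ENNReal.ofReal_mul' (by positivity), ofReal_norm_rpow (by linarith)]

theorem gradient_neg {N : ℕ} (f : EuclideanSpace ℝ (Fin N) → ℝ) (x : EuclideanSpace ℝ (Fin N)) :
    gradient (fun y => -f y) x = -gradient f x := by
  rw [gradient, gradient, fderiv_fun_neg, map_neg]

namespace ApproxSolution

variable {N : ℕ} {p R₁ lam : ℝ} {L K u : EuclideanSpace ℝ (Fin N) → ℝ}
  {G : EuclideanSpace ℝ (Fin N) → EuclideanSpace ℝ (Fin N)}
  {φ : ℕ → EuclideanSpace ℝ (Fin N) → ℝ}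

theorem neg (h : ApproxSolution p R₁ L K lam u G φ) :
    ApproxSolution p R₁ L K lam (fun x => -u x) (fun x => -G x) (fun n x => -φ n x) where
  aemeasurable_L := h.aemeasurable_L
  aemeasurable_K := h.aemeasurable_K
  pos_L := h.pos_L
  locallyIntegrable_L := h.locallyIntegrable_L
  meas_u := h.meas_u.neg
  meas_G := h.meas_G.neg
  isTest := fun n => by
    obtain ⟨h1, h2, h3⟩ := h.isTest n
    have : tsupport (fun x => -φ n x) = tsupport (φ n) := by
      rw [tsupport, tsupport]; congr 1; ext x; simp
    exact ⟨h1.neg, h2.neg, this ▸ h3⟩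
  tendsto_gradient := by
    refine h.tendsto_gradient.congr fun n => lintegral_congr fun x => ?_
    rw [gradient_neg, ← enorm_neg, neg_sub, sub_neg_eq_add, neg_add_eq_sub]
  tendsto_local := fun C hC hCs => by
    refine (h.tendsto_local C hC hCs).congr fun n => lintegral_congr fun x => ?_
    rw [← abs_neg, neg_sub, sub_neg_eq_add, neg_add_eq_sub]
  equation := fun ψ hψ => by
    have := h.equation ψ hψ
    simp only [norm_neg, inner_neg_left, mul_neg, neg_mul, abs_neg, integral_neg, this]

theorem lintegral_gradient_ne_top (hp : 1 < p) (h : ApproxSolution p R₁ L K lam u G φ) :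
    ∫⁻ x in exteriorBall N R₁, ENNReal.ofReal (L x) * ‖G x‖ₑ ^ p ≠ ∞ := by
  have hp0 : 0 < p := by linarith
  obtain ⟨n, hn⟩ := (h.tendsto_gradient.eventually (gt_mem_nhds one_pos)).exists
  have hgm : AEStronglyMeasurable (gradient (φ n)) (volume.restrict (exteriorBall N R₁)) :=
    (continuous_gradient (h.isTest n).1).aestronglyMeasurable
  have m1 : AEMeasurable (fun x => ENNReal.ofReal (L x) * ‖gradient (φ n) x - G x‖ₑ ^ p)
      (volume.restrict (exteriorBall N R₁)) :=
    h.aemeasurable_L.ennreal_ofReal.mul ((hgm.sub h.meas_G).enorm.pow_const _)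
  have h2 : (2 : ℝ≥0∞) ^ (p - 1) ≠ ∞ := ENNReal.rpow_ne_top_of_nonneg (by linarith) (by simp)
  refine ne_of_lt ?_
  calc ∫⁻ x in exteriorBall N R₁, ENNReal.ofReal (L x) * ‖G x‖ₑ ^ p
      ≤ ∫⁻ x in exteriorBall N R₁, 2 ^ (p - 1) * (ENNReal.ofReal (L x) *
          ‖gradient (φ n) x - G x‖ₑ ^ p + ENNReal.ofReal (L x) * ‖gradient (φ n) x‖ₑ ^ p) := by
        refine lintegral_mono fun x => ?_
        rw [← mul_add, mul_left_comm]
        gcongr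
        refine le_trans ?_ (ENNReal.rpow_add_le_mul_rpow_add_rpow _ _ hp.le)
        gcongr
        calc ‖G x‖ₑ = ‖gradient (φ n) x - (gradient (φ n) x - G x)‖ₑ := by rw [sub_sub_cancel]
          _ ≤ _ := enorm_sub_le
          _ = _ := add_comm _ _
    _ = 2 ^ (p - 1) * ((∫⁻ x in exteriorBall N R₁, ENNReal.ofReal (L x) *
          ‖gradient (φ n) x - G x‖ₑ ^ p) +
          ∫⁻ x in exteriorBall N R₁, ENNReal.ofReal (L x) * ‖gradient (φ n) x‖ₑ ^ p) := by
        rw [lintegral_const_mul' _ _ h2, lintegral_add_left' m1]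
    _ < ∞ := ENNReal.mul_lt_top h2.lt_top (ENNReal.add_lt_top.2
        ⟨hn.trans ENNReal.one_lt_top,
          lintegral_weight_gradient_lt_top hp0 h.locallyIntegrable_L (h.isTest n)⟩)

theorem tendsto_gradient_error (hp : 1 < p) (h : ApproxSolution p R₁ L K lam u G φ) :
    Tendsto (fun n => ∫⁻ x in exteriorBall N R₁, ENNReal.ofReal (L x) *
      (‖G x‖ₑ ^ (p - 1) * ‖gradient (φ n) x - G x‖ₑ)) atTop (𝓝 0) := by
  have hp0 : 0 < p := by linarith
  have hlim := (ENNReal.Tendsto.const_mul (a := (∫⁻ x in exteriorBall N R₁,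
    ENNReal.ofReal (L x) * ‖G x‖ₑ ^ p) ^ ((p - 1) / p))
    (h.tendsto_gradient.ennrpow_const (1 / p))
    (Or.inr (ENNReal.rpow_ne_top_of_nonneg (div_nonneg (by linarith) hp0.le)
      (h.lintegral_gradient_ne_top hp))))
  rw [ENNReal.zero_rpow_of_pos (by positivity), mul_zero] at hlim
  refine tendsto_of_tendsto_of_tendsto_of_le_of_le tendsto_const_nhds hlim (fun _ => zero_le)
    fun n => ?_
  exact lintegral_weighted_holder hp h.aemeasurable_L.ennreal_ofReal h.meas_G.enorm
    ((continuous_gradient (h.isTest n).1).aestronglyMeasurable.sub h.meas_G).enorm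

/-- The approximating sequence converges to `u` in `L^{p*}` on compact sets, with a bound that
does not depend on the compact set. -/
theorem exists_eLpNorm_sub_le (hp : 1 < p) (hpN : p < N) {R R' c : ℝ} (hR₁ : 0 < R₁) (hR : R₁ < R)
    (hRR : R < R') (hc : 0 < c) (hcL : ∀ᵐ x ∂(volume.restrict (exteriorBall N R)), c ≤ L x)
    (h : ApproxSolution p R₁ L K lam u G φ) :
    ∃ C : ℝ≥0∞, C ≠ ∞ ∧ ∀ n, ∀ S : Set (EuclideanSpace ℝ (Fin N)), IsCompact S →
      S ⊆ exteriorBall N R' →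
      eLpNorm (fun x => φ n x - u x) (ENNReal.ofReal (sobolevExp N p)) (volume.restrict S) ^ p ≤
        C * ∫⁻ x in exteriorBall N R₁, ENNReal.ofReal (L x) * ‖gradient (φ n) x - G x‖ₑ ^ p := by
  have hp0 : 0 < p := by linarith
  obtain ⟨C₀, hC₀, hS⟩ := exists_exterior_sobolev_constant hp hpN (hR₁.trans hR) hRR
  set a : ℕ → ℝ≥0∞ := fun n => ∫⁻ x in exteriorBall N R₁,
    ENNReal.ofReal (L x) * ‖gradient (φ n) x - G x‖ₑ ^ p with ha
  have h2 : (2 : ℝ≥0∞) ^ (p - 1) ≠ ∞ := ENNReal.rpow_ne_top_of_nonneg (by linarith) (by simp)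
  have hc' : (ENNReal.ofReal c)⁻¹ ≠ ∞ := by simpa using hc
  have hsub : exteriorBall N R ⊆ exteriorBall N R₁ := fun x hx => hR.trans hx
  set C : ℝ≥0∞ := C₀ * ((ENNReal.ofReal c)⁻¹ * 2 ^ (p - 1)) with hC
  have hCf : C ≠ ∞ := ENNReal.mul_ne_top hC₀ (ENNReal.mul_ne_top hc' h2)
  have hgd : ∀ n, ContDiff ℝ 1 (φ n) := fun n => (h.isTest n).1
  have hdiff : ∀ n m, eLpNorm (fun x => φ n x - φ m x) (ENNReal.ofReal (sobolevExp N p))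
      (volume.restrict (exteriorBall N R')) ^ p ≤ C * (a n + a m) := by
    intro n m
    have hg : ∀ x, gradient (fun x => φ n x - φ m x) x = gradient (φ n) x - gradient (φ m) x := by
      intro x
      rw [gradient, gradient, gradient, fderiv_fun_sub ((hgd n).differentiable one_ne_zero x)
        ((hgd m).differentiable one_ne_zero x), map_sub]
    refine (hS _ ((hgd n).sub (hgd m)) ((h.isTest n).2.1.sub (h.isTest m).2.1)).trans ?_
    rw [hC, mul_assoc, mul_assoc]
    gcongr
    have m1 : AEMeasurable (fun x => ENNReal.ofReal (L x) * ‖gradient (φ n) x - G x‖ₑ ^ p)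
        (volume.restrict (exteriorBall N R₁)) :=
      h.aemeasurable_L.ennreal_ofReal.mul
        (((continuous_gradient (hgd n)).aestronglyMeasurable.sub h.meas_G).enorm.pow_const _)
    calc ∫⁻ x in exteriorBall N R, ‖gradient (fun x => φ n x - φ m x) x‖ₑ ^ p
        ≤ ∫⁻ x in exteriorBall N R, (ENNReal.ofReal c)⁻¹ * (2 ^ (p - 1) * (ENNReal.ofReal (L x) *
          ‖gradient (φ n) x - G x‖ₑ ^ p + ENNReal.ofReal (L x) *
            ‖gradient (φ m) x - G x‖ₑ ^ p)) := by
          refine lintegral_mono_ae ?_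
          filter_upwards [hcL] with x hx
          rw [hg]
          have e1 : ‖gradient (φ n) x - gradient (φ m) x‖ₑ ^ p ≤ 2 ^ (p - 1) *
              (‖gradient (φ n) x - G x‖ₑ ^ p + ‖gradient (φ m) x - G x‖ₑ ^ p) := by
            refine le_trans ?_ (ENNReal.rpow_add_le_mul_rpow_add_rpow _ _ hp.le)
            gcongr
            rw [← sub_sub_sub_cancel_right _ _ (G x)]
            exact enorm_sub_le
          have e2 : 1 ≤ (ENNReal.ofReal c)⁻¹ * ENNReal.ofReal (L x) := by
            rw [← ENNReal.inv_mul_cancel (a := ENNReal.ofReal c) (by simpa using hc)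
              ENNReal.ofReal_ne_top]
            gcongr
          calc _ ≤ ((ENNReal.ofReal c)⁻¹ * ENNReal.ofReal (L x)) * _ :=
                le_mul_of_one_le_of_le e2 e1
            _ = _ := by ring
      _ ≤ ∫⁻ x in exteriorBall N R₁, (ENNReal.ofReal c)⁻¹ * (2 ^ (p - 1) * (ENNReal.ofReal (L x) *
          ‖gradient (φ n) x - G x‖ₑ ^ p + ENNReal.ofReal (L x) *
            ‖gradient (φ m) x - G x‖ₑ ^ p)) := lintegral_mono_set hsub
      _ = (ENNReal.ofReal c)⁻¹ * (2 ^ (p - 1) * (a n + a m)) := by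
          rw [lintegral_const_mul' _ _ hc', lintegral_const_mul' _ _ h2, lintegral_add_left' m1]
  refine ⟨C, hCf, fun n S hSc hSR => ?_⟩
  have hSR₁ : S ⊆ exteriorBall N R₁ := fun x hx => hR.trans (hRR.trans (hSR hx))
  have hum : AEStronglyMeasurable u (volume.restrict S) := h.meas_u.mono_set hSR₁
  have hφm : ∀ m, AEStronglyMeasurable (φ m) (volume.restrict S) := fun m =>
    (hgd m).continuous.aestronglyMeasurable
  have hmeas : TendstoInMeasure (volume.restrict S) φ atTop u := by
    refine tendstoInMeasure_of_tendsto_eLpNorm one_ne_zero hφm hum ?_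
    refine (h.tendsto_local S hSc hSR₁).congr fun m => ?_
    rw [eLpNorm_one_eq_lintegral_enorm]
    refine lintegral_congr fun x => ?_
    rw [Pi.sub_apply, ← ofReal_norm, Real.norm_eq_abs]
  obtain ⟨ns, hns, hae⟩ := hmeas.exists_seq_tendsto_ae
  -- lower semicontinuity of the norm along an almost everywhere convergent subsequence
  have hfatou := Lp.eLpNorm_lim_le_liminf_eLpNorm (p := ENNReal.ofReal (sobolevExp N p))
    (f := fun m x => φ n x - φ (ns m) x) (μ := volume.restrict S)
    (fun m => (hφm n).sub (hφm (ns m))) (fun x => φ n x - u x) (by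
      filter_upwards [hae] with x hx using hx.const_sub _)
  have hle : ∀ m, eLpNorm (fun x => φ n x - φ (ns m) x) (ENNReal.ofReal (sobolevExp N p))
      (volume.restrict S) ≤ (C * (a n + a (ns m))) ^ p⁻¹ := by
    intro m
    rw [ENNReal.le_rpow_inv_iff hp0]
    refine le_trans ?_ (hdiff n (ns m))
    gcongr
  have hlim : Tendsto (fun m => (C * (a n + a (ns m))) ^ p⁻¹) atTop (𝓝 ((C * a n) ^ p⁻¹)) := by
    have h1 : Tendsto (fun m => a (ns m)) atTop (𝓝 0) :=
      h.tendsto_gradient.comp hns.tendsto_atTop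
    have h3 := ENNReal.Tendsto.const_mul (a := C) (h1.const_add (a n)) (Or.inr hCf)
    rw [add_zero] at h3
    exact h3.ennrpow_const _
  rw [← ENNReal.le_rpow_inv_iff hp0]
  calc _ ≤ _ := hfatou
    _ ≤ liminf (fun m => (C * (a n + a (ns m))) ^ p⁻¹) atTop :=
        liminf_le_liminf (Eventually.of_forall hle)
    _ = _ := hlim.liminf_eq

end ApproxSolution

/-! ### The Caccioppoli inequality and the De Giorgi iteration -/

theorem ofReal_max_sub_le {a h s t : ℝ} (hah : a ≤ h) :
    ENNReal.ofReal (max (s - h) 0) ≤ ENNReal.ofReal (max (t - a) 0) + ‖s - t‖ₑ := by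
  rw [← ofReal_norm, ← ENNReal.ofReal_add (le_max_right _ _) (norm_nonneg _)]
  refine ENNReal.ofReal_le_ofReal (max_le ?_ (by positivity))
  have h1 := le_max_left (t - a) 0
  have h2 := le_abs_self (s - t)
  rw [Real.norm_eq_abs]
  linarith

/-- Above the level `(a + k) / 2`, the function `t` is controlled by `t - a`. -/
theorem enorm_rpow_mul_max_le {p a k t : ℝ} (hp : 1 < p) (ha : 0 ≤ a) (hak : a < k) :
    ‖t‖ₑ ^ (p - 1) * ENNReal.ofReal (max (t - (a + k) / 2) 0) ≤
      ENNReal.ofReal (2 * k / (k - a)) ^ (p - 1) * ENNReal.ofReal (max (t - a) 0) ^ p := by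
  rcases le_or_gt t ((a + k) / 2) with ht | ht
  · rw [max_eq_right (by linarith)]; simp
  have hd : 0 < k - a := by linarith
  have ht0 : 0 < t - a := by linarith
  have e : ENNReal.ofReal (max (t - a) 0) ^ p =
      ENNReal.ofReal (t - a) ^ (p - 1) * ENNReal.ofReal (t - a) := by
    have := ENNReal.rpow_add_of_nonneg (x := ENNReal.ofReal (t - a)) (p - 1) 1 (by linarith)
      zero_le_one
    rw [sub_add_cancel, ENNReal.rpow_one] at this
    rw [max_eq_left ht0.le, this]
  rw [e, ← mul_assoc, ← ENNReal.mul_rpow_of_nonneg _ _ (by linarith),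
    ← ENNReal.ofReal_mul (div_nonneg (by linarith) hd.le), ← ofReal_norm]
  refine mul_le_mul' (ENNReal.rpow_le_rpow (ENNReal.ofReal_le_ofReal ?_) (by linarith))
    (ENNReal.ofReal_le_ofReal (max_le (by linarith) ht0.le))
  rw [Real.norm_of_nonneg (by linarith), div_mul_eq_mul_div, le_div_iff₀ hd]
  nlinarith [mul_pos hd hd]

namespace ApproxSolution

variable {N : ℕ} {p R₁ lam : ℝ} {L K u : EuclideanSpace ℝ (Fin N) → ℝ}
  {G : EuclideanSpace ℝ (Fin N) → EuclideanSpace ℝ (Fin N)}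
  {φ : ℕ → EuclideanSpace ℝ (Fin N) → ℝ}

/-- The Caccioppoli inequality combined with Sobolev's inequality, for one member of the
approximating sequence. -/
theorem exists_truncation_le (hp : 1 < p) (hpN : p < N) {R c : ℝ}
    (hR : R₁ < R) (hc : 0 < c) (hcL : ∀ᵐ x ∂(volume.restrict (exteriorBall N R)), c ≤ L x)
    (h : ApproxSolution p R₁ L K lam u G φ) :
    ∃ C : ℝ≥0∞, C ≠ ∞ ∧ ∃ D : ℝ, 0 < D ∧ ∀ n, ∀ (x₀ : EuclideanSpace ℝ (Fin N)) (s r a k : ℝ),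
      0 ≤ s → s < r → Metric.ball x₀ r ⊆ exteriorBall N R → 0 ≤ a → a < k →
      eLpNorm (fun x => max (φ n x - k) 0) (ENNReal.ofReal (sobolevExp N p))
          (volume.restrict (Metric.ball x₀ s)) ^ p ≤
        C * (ENNReal.ofReal |lam| *
            (ENNReal.ofReal (2 * k / (k - a)) ^ (p - 1) *
              (∫⁻ x in Metric.ball x₀ r, ‖K x‖ₑ * ‖max (u x - a) 0‖ₑ ^ p) +
              ∫⁻ x in Metric.ball x₀ r, ‖K x‖ₑ * (‖u x‖ₑ ^ (p - 1) * ‖φ n x - u x‖ₑ)) +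
          (∫⁻ x in exteriorBall N R₁, ENNReal.ofReal (L x) *
            (‖G x‖ₑ ^ (p - 1) * ‖gradient (φ n) x - G x‖ₑ)) +
          (∫⁻ x in exteriorBall N R₁, ENNReal.ofReal (L x) * ‖gradient (φ n) x - G x‖ₑ ^ p) +
          ENNReal.ofReal (D / (r - s)) ^ p * (2 ^ (p - 1) *
            ((∫⁻ x in Metric.ball x₀ r, ‖L x‖ₑ * ‖max (u x - a) 0‖ₑ ^ p) +
              ∫⁻ x in Metric.ball x₀ r, ‖L x‖ₑ * ‖φ n x - u x‖ₑ ^ p))) := by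
  have hp0 : 0 < p := by linarith
  obtain ⟨S, hS, hSob⟩ := exists_sobolev_constant hp hpN
  obtain ⟨D, hD0, hD⟩ := exists_cutoff N
  have hc' : (ENNReal.ofReal c)⁻¹ ≠ ∞ := by simpa using hc
  have h2 : (2 : ℝ≥0∞) ^ (p - 1) ≠ ∞ := ENNReal.rpow_ne_top_of_nonneg (by linarith) (by simp)
  refine ⟨S * ((ENNReal.ofReal c)⁻¹ * ENNReal.ofReal (energyConst p)),
    ENNReal.mul_ne_top hS (ENNReal.mul_ne_top hc' ENNReal.ofReal_ne_top), D, hD0, ?_⟩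
  intro n x₀ s r a k hs hsr hB ha hak
  obtain ⟨η, hη, hη0, hη1, hηin, hηout, hηg, hηgout⟩ := hD x₀ s r hs hsr
  -- truncating between the levels `l` and `k` leaves a gap above `a`, which is what bounds `u` by a
  -- multiple of `u - a` in the term with `K`
  set l := (a + k) / 2 with hl
  have hlk : l < k := by rw [hl]; linarith
  have hal : a < l := by rw [hl]; linarith
  obtain ⟨Φ, Φ', hΦ, hΦc, hΦ'0, hΦ'1, hΦk, hΦl⟩ := exists_smooth_posPart hlk
  have hΦ0 : ∀ t, 0 ≤ Φ t := fun t => (le_max_right _ _).trans (hΦk t)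
  have hΦle : ∀ t, Φ t ≤ max (t - l) 0 := fun t =>
    (hΦl t).trans (mul_le_of_le_one_right (le_max_right _ _) (hΦ'1 t))
  have hΦz : Φ 0 = 0 :=
    le_antisymm ((hΦle 0).trans (max_le (by linarith) le_rfl)) (hΦ0 0)
  have hφd : ContDiff ℝ 1 (φ n) := (h.isTest n).1
  have hΦd : ContDiff ℝ 1 Φ := by
    rw [contDiff_one_iff_deriv]
    refine ⟨fun t => (hΦ t).differentiableAt, ?_⟩
    rwa [show deriv Φ = Φ' from funext fun t => (hΦ t).deriv]
  have hBR₁ : Metric.ball x₀ r ⊆ exteriorBall N R₁ := fun x hx => hR.trans (hB hx)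
  have hBm : MeasurableSet (Metric.ball x₀ r) := measurableSet_ball
  set w : EuclideanSpace ℝ (Fin N) → ℝ := fun y => η y * Φ (φ n y) with hw
  have hwd : ContDiff ℝ 1 w := hη.mul (hΦd.comp hφd)
  have hwc : HasCompactSupport w := ((h.isTest n).2.1.comp_left hΦz).mul_left
  have hgw : ∀ x ∉ Metric.ball x₀ r, gradient w x = 0 := by
    intro x hx
    have h2 := hasGradientAt_comp (hΦ (φ n x)) (hasGradientAt_of_contDiff hφd x)
    rw [(hasGradientAt_mul (hasGradientAt_of_contDiff hη x) h2).gradient, hηgout x hx, hηout x hx]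
    simp
  have hoff : ∀ (f g : EuclideanSpace ℝ (Fin N) → ℝ≥0∞), (∀ x ∉ Metric.ball x₀ r, f x = 0) →
      (∀ x ∈ Metric.ball x₀ r, f x ≤ g x) → ∀ T : Set (EuclideanSpace ℝ (Fin N)),
      ∫⁻ x in T, f x ≤ ∫⁻ x in Metric.ball x₀ r, g x := by
    intro f g hf0 hfg T
    rw [← lintegral_indicator hBm]
    refine (setLIntegral_le_lintegral _ _).trans (lintegral_mono fun x => ?_)
    by_cases hx : x ∈ Metric.ball x₀ r
    · rw [indicator_of_mem hx]; exact hfg x hx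
    · rw [hf0 x hx]; exact zero_le
  -- Sobolev's inequality for the truncated function
  have step1 : eLpNorm (fun x => max (φ n x - k) 0) (ENNReal.ofReal (sobolevExp N p))
      (volume.restrict (Metric.ball x₀ s)) ^ p ≤ S * ∫⁻ x, ‖gradient w x‖ₑ ^ p := by
    refine le_trans (ENNReal.rpow_le_rpow ?_ hp0.le) (hSob w hwd hwc)
    calc _ ≤ eLpNorm w (ENNReal.ofReal (sobolevExp N p)) (volume.restrict (Metric.ball x₀ s)) := by
          refine eLpNorm_mono_ae ?_
          filter_upwards [ae_restrict_mem measurableSet_ball] with x hx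
          rw [hw, Real.norm_of_nonneg (le_max_right _ _), Real.norm_of_nonneg
            (mul_nonneg (hη0 x) (hΦ0 _)), hηin x (Metric.ball_subset_closedBall hx), one_mul]
          exact hΦk _
      _ ≤ _ := eLpNorm_mono_measure _ Measure.restrict_le_self
  have step2 : ∫⁻ x, ‖gradient w x‖ₑ ^ p ≤
      (ENNReal.ofReal c)⁻¹ * ∫⁻ x in exteriorBall N R₁, ENNReal.ofReal (L x) * ‖gradient w x‖ₑ ^ p := by
    calc ∫⁻ x, ‖gradient w x‖ₑ ^ p = ∫⁻ x in univ, ‖gradient w x‖ₑ ^ p := by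
          rw [Measure.restrict_univ]
      _ ≤ ∫⁻ x in Metric.ball x₀ r, ‖gradient w x‖ₑ ^ p := by
          refine hoff _ _ (fun x hx => ?_) (fun x _ => le_rfl) _
          rw [hgw x hx, enorm_zero, ENNReal.zero_rpow_of_pos hp0]
      _ ≤ ∫⁻ x in Metric.ball x₀ r, (ENNReal.ofReal c)⁻¹ *
            (ENNReal.ofReal (L x) * ‖gradient w x‖ₑ ^ p) := by
          refine lintegral_mono_ae ?_
          filter_upwards [ae_restrict_of_ae_restrict_of_subset hB hcL] with x hx
          have e2 : 1 ≤ (ENNReal.ofReal c)⁻¹ * ENNReal.ofReal (L x) := by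
            rw [← ENNReal.inv_mul_cancel (a := ENNReal.ofReal c) (by simpa using hc)
              ENNReal.ofReal_ne_top]
            gcongr
          rw [← mul_assoc]
          exact le_mul_of_one_le_left' e2
      _ ≤ ∫⁻ x in exteriorBall N R₁, (ENNReal.ofReal c)⁻¹ *
            (ENNReal.ofReal (L x) * ‖gradient w x‖ₑ ^ p) := lintegral_mono_set hBR₁
      _ = _ := lintegral_const_mul' _ _ hc'
  have step3 := lintegral_energy_le hp (ha.trans hal.le) h.aemeasurable_L h.pos_L
    h.locallyIntegrable_L h.meas_G (h.lintegral_gradient_ne_top hp) h.equation (h.isTest n) hη hη0 hη1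
    hΦ hΦc hΦ0 hΦ'0 hΦ'1 hΦl
  have hKm : AEMeasurable (fun x => ‖K x‖ₑ) (volume.restrict (Metric.ball x₀ r)) :=
    (h.aemeasurable_K.mono_set hBR₁).enorm
  have hLm : AEMeasurable (fun x => ‖L x‖ₑ) (volume.restrict (Metric.ball x₀ r)) :=
    (h.aemeasurable_L.mono_set hBR₁).enorm
  have hum : AEMeasurable u (volume.restrict (Metric.ball x₀ r)) :=
    (h.meas_u.mono_set hBR₁).aemeasurable
  have hum' : AEMeasurable (fun x => ‖max (u x - a) 0‖ₑ) (volume.restrict (Metric.ball x₀ r)) :=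
    ((hum.sub_const a).max aemeasurable_const).enorm
  have henm : ∀ t : ℝ, ‖max t 0‖ₑ = ENNReal.ofReal (max t 0) := fun t =>
    Real.enorm_eq_ofReal (le_max_right _ _)
  have stepK : ∫⁻ x in exteriorBall N R₁, ‖K x‖ₑ * (‖u x‖ₑ ^ (p - 1) *
        ENNReal.ofReal (η x ^ p * Φ (φ n x))) ≤
      ENNReal.ofReal (2 * k / (k - a)) ^ (p - 1) *
        (∫⁻ x in Metric.ball x₀ r, ‖K x‖ₑ * ‖max (u x - a) 0‖ₑ ^ p) +
      ∫⁻ x in Metric.ball x₀ r, ‖K x‖ₑ * (‖u x‖ₑ ^ (p - 1) * ‖φ n x - u x‖ₑ) := by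
    have m1 : AEMeasurable (fun x => ‖K x‖ₑ * ‖max (u x - a) 0‖ₑ ^ p)
      (volume.restrict (Metric.ball x₀ r)) := hKm.mul (hum'.pow_const _)
    rw [← lintegral_const_mul'' _ m1, ← lintegral_add_left' (m1.const_mul _)]
    refine hoff _ _ (fun x hx => ?_) (fun x _ => ?_) _
    · rw [hηout x hx, Real.zero_rpow hp0.ne']; simp
    · have e1 : ENNReal.ofReal (η x ^ p * Φ (φ n x)) ≤
          ENNReal.ofReal (max (u x - l) 0) + ‖φ n x - u x‖ₑ := by
        refine le_trans (ENNReal.ofReal_le_ofReal ?_) (ofReal_max_sub_le le_rfl)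
        exact (mul_le_of_le_one_left (hΦ0 _) (Real.rpow_le_one (hη0 x) (hη1 x) hp0.le)).trans (hΦle _)
      calc _ ≤ ‖K x‖ₑ * (‖u x‖ₑ ^ (p - 1) *
              (ENNReal.ofReal (max (u x - l) 0) + ‖φ n x - u x‖ₑ)) := by gcongr
        _ = ‖K x‖ₑ * (‖u x‖ₑ ^ (p - 1) * ENNReal.ofReal (max (u x - l) 0)) +
            ‖K x‖ₑ * (‖u x‖ₑ ^ (p - 1) * ‖φ n x - u x‖ₑ) := by ring
        _ ≤ ‖K x‖ₑ * (ENNReal.ofReal (2 * k / (k - a)) ^ (p - 1) *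
              ENNReal.ofReal (max (u x - a) 0) ^ p) +
            ‖K x‖ₑ * (‖u x‖ₑ ^ (p - 1) * ‖φ n x - u x‖ₑ) := by
            exact add_le_add (mul_le_mul_right (enorm_rpow_mul_max_le hp ha hak) _) le_rfl
        _ = _ := by rw [henm]; ring
  have stepL : ∫⁻ x in exteriorBall N R₁, ENNReal.ofReal (L x) * (‖gradient η x‖ₑ ^ p *
        ENNReal.ofReal (max (φ n x - l) 0) ^ p) ≤
      ENNReal.ofReal (D / (r - s)) ^ p * (2 ^ (p - 1) *
            ((∫⁻ x in Metric.ball x₀ r, ‖L x‖ₑ * ‖max (u x - a) 0‖ₑ ^ p) +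
              ∫⁻ x in Metric.ball x₀ r, ‖L x‖ₑ * ‖φ n x - u x‖ₑ ^ p)) := by
    have m1 : AEMeasurable (fun x => ‖L x‖ₑ * ‖max (u x - a) 0‖ₑ ^ p)
      (volume.restrict (Metric.ball x₀ r)) := hLm.mul (hum'.pow_const _)
    rw [← lintegral_add_left' m1, ← lintegral_const_mul' _ _ h2, ← lintegral_const_mul' _ _
      (ENNReal.rpow_ne_top_of_nonneg hp0.le ENNReal.ofReal_ne_top)]
    refine hoff _ _ (fun x hx => ?_) (fun x _ => ?_) _
    · rw [hηgout x hx, enorm_zero, ENNReal.zero_rpow_of_pos hp0]; simp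
    · have e1 : ENNReal.ofReal (max (φ n x - l) 0) ^ p ≤
          2 ^ (p - 1) * (‖max (u x - a) 0‖ₑ ^ p + ‖φ n x - u x‖ₑ ^ p) := by
        refine le_trans (ENNReal.rpow_le_rpow ?_ hp0.le)
          (ENNReal.rpow_add_le_mul_rpow_add_rpow _ _ hp.le)
        rw [henm]
        exact ofReal_max_sub_le hal.le
      have e2 : ‖gradient η x‖ₑ ≤ ENNReal.ofReal (D / (r - s)) := by
        rw [← ofReal_norm]; exact ENNReal.ofReal_le_ofReal (hηg x)
      calc _ ≤ ‖L x‖ₑ * (ENNReal.ofReal (D / (r - s)) ^ p *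
              (2 ^ (p - 1) * (‖max (u x - a) 0‖ₑ ^ p + ‖φ n x - u x‖ₑ ^ p))) := by
            gcongr
            exact Real.ofReal_le_enorm _
        _ = _ := by ring
  calc _ ≤ S * ((ENNReal.ofReal c)⁻¹ * ∫⁻ x in exteriorBall N R₁,
          ENNReal.ofReal (L x) * ‖gradient w x‖ₑ ^ p) := step1.trans (by gcongr)
    _ ≤ S * ((ENNReal.ofReal c)⁻¹ * (ENNReal.ofReal (energyConst p) * _)) :=
        mul_le_mul_right (mul_le_mul_right (step3.trans (mul_le_mul_right
          (add_le_add (add_le_add (add_le_add (mul_le_mul_right stepK _) le_rfl) le_rfl) stepL) _)) _) _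
    _ = _ := by ring

end ApproxSolution

theorem lt_sobolevExp_pos {N : ℕ} {p q : ℝ} (hp : 1 < p) (hpq : p ≤ q) (hq : q < sobolevExp N p) :
    0 < q ∧ 0 < sobolevExp N p ∧ 0 < 1 / q - 1 / sobolevExp N p := by
  have h1 : 0 < q := by linarith
  have h2 := h1.trans hq
  exact ⟨h1, h2, sub_pos.2 (one_div_lt_one_div_of_lt h1 hq)⟩

theorem eLpNorm_le_eLpNorm_mul_measure {α : Type*} [MeasurableSpace α] {ν : Measure α} {q r : ℝ}
    (hq : 0 < q) (hqr : q < r) {f : α → ℝ} (hf : AEStronglyMeasurable f ν) :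
    eLpNorm f (ENNReal.ofReal q) ν ≤ eLpNorm f (ENNReal.ofReal r) ν * ν univ ^ (1 / q - 1 / r) := by
  have := eLpNorm_le_eLpNorm_mul_rpow_measure_univ (μ := ν) (p := ENNReal.ofReal q)
    (q := ENNReal.ofReal r) (ENNReal.ofReal_le_ofReal hqr.le) hf
  rwa [ENNReal.toReal_ofReal hq.le, ENNReal.toReal_ofReal (hq.trans hqr).le] at this

/-- Hölder's inequality on the set where `f > b`, whose measure is estimated by Chebyshev's
inequality at the lower level `a`. -/
theorem eLpNorm_truncation_le {α : Type*} [MeasurableSpace α] {ν : Measure α} {q r a b : ℝ}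
    (hq : 0 < q) (hqr : q < r) (hab : a < b) {f : α → ℝ} (hf : AEStronglyMeasurable f ν) :
    eLpNorm (fun x => max (f x - b) 0) (ENNReal.ofReal q) ν ≤
      eLpNorm (fun x => max (f x - b) 0) (ENNReal.ofReal r) ν *
        ((ENNReal.ofReal (b - a))⁻¹ *
          eLpNorm (fun x => max (f x - a) 0) (ENNReal.ofReal q) ν) ^ (1 - q / r) := by
  have hr : 0 < r := hq.trans hqr
  have hd : ENNReal.ofReal (b - a) ≠ 0 := by simpa using hab
  have hm : ∀ c, AEStronglyMeasurable (fun x => max (f x - c) 0) ν := fun c =>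
    ((hf.aemeasurable.sub_const c).max aemeasurable_const).aestronglyMeasurable
  set S := toMeasurable ν {x | b < f x} with hS
  have hSm : MeasurableSet S := measurableSet_toMeasurable _ _
  have hind : (fun x => max (f x - b) 0) = S.indicator fun x => max (f x - b) 0 := by
    ext x
    by_cases hx : x ∈ S
    · rw [indicator_of_mem hx]
    · rw [indicator_of_notMem hx]
      have : ¬ b < f x := fun h => hx (subset_toMeasurable _ _ h)
      exact max_eq_right (by linarith)
  have hνS : ν S ≤ ((ENNReal.ofReal (b - a))⁻¹ *
      eLpNorm (fun x => max (f x - a) 0) (ENNReal.ofReal q) ν) ^ q := by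
    have h1 := mul_meas_ge_le_pow_eLpNorm' (p := ENNReal.ofReal q) ν (by simpa using hq)
      ENNReal.ofReal_ne_top (hm a) (ENNReal.ofReal (b - a))
    rw [ENNReal.toReal_ofReal hq.le] at h1
    have h2 : ν S ≤ ν {x | ENNReal.ofReal (b - a) ≤ ‖max (f x - a) 0‖ₑ} := by
      rw [hS, measure_toMeasurable]
      refine measure_mono fun x hx => ?_
      have hx' : b < f x := hx
      change ENNReal.ofReal (b - a) ≤ ‖max (f x - a) 0‖ₑ
      rw [Real.enorm_eq_ofReal (le_max_right _ _)]
      exact ENNReal.ofReal_le_ofReal ((by linarith : b - a ≤ f x - a).trans (le_max_left _ _))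
    rw [ENNReal.mul_rpow_of_nonneg _ _ hq.le, ENNReal.inv_rpow]
    rw [mul_comm, ← div_eq_mul_inv, ENNReal.le_div_iff_mul_le
      (Or.inl (by simp [hd])) (Or.inl (ENNReal.rpow_ne_top_of_nonneg hq.le ENNReal.ofReal_ne_top))]
    rw [mul_comm]
    exact (mul_le_mul_right h2 _).trans h1
  calc eLpNorm (fun x => max (f x - b) 0) (ENNReal.ofReal q) ν
      = eLpNorm (fun x => max (f x - b) 0) (ENNReal.ofReal q) (ν.restrict S) := by
        rw [← eLpNorm_indicator_eq_eLpNorm_restrict hSm, ← hind]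
    _ ≤ eLpNorm (fun x => max (f x - b) 0) (ENNReal.ofReal r) (ν.restrict S) *
          ν.restrict S univ ^ (1 / q - 1 / r) :=
        eLpNorm_le_eLpNorm_mul_measure hq hqr (hm b).restrict
    _ ≤ eLpNorm (fun x => max (f x - b) 0) (ENNReal.ofReal r) ν *
          (((ENNReal.ofReal (b - a))⁻¹ *
          eLpNorm (fun x => max (f x - a) 0) (ENNReal.ofReal q) ν) ^ q) ^ (1 / q - 1 / r) := by
        have h3 : 0 ≤ 1 / q - 1 / r := (sub_pos.2 (one_div_lt_one_div_of_lt hq hqr)).le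
        rw [Measure.restrict_apply_univ]
        gcongr
        exact Measure.restrict_le_self
    _ = _ := by
        rw [← ENNReal.rpow_mul]
        congr 2
        field_simp

namespace ApproxSolution

variable {N : ℕ} {p R₁ lam : ℝ} {L K u : EuclideanSpace ℝ (Fin N) → ℝ}
  {G : EuclideanSpace ℝ (Fin N) → EuclideanSpace ℝ (Fin N)}
  {φ : ℕ → EuclideanSpace ℝ (Fin N) → ℝ}

theorem tendsto_eLpNorm_sobolevExp (hp : 1 < p) (hpN : p < N) {R R' c : ℝ} (hR₁ : 0 < R₁)
    (hR : R₁ < R) (hRR : R < R') (hc : 0 < c)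
    (hcL : ∀ᵐ x ∂(volume.restrict (exteriorBall N R)), c ≤ L x)
    (h : ApproxSolution p R₁ L K lam u G φ) {S : Set (EuclideanSpace ℝ (Fin N))} (hS : IsCompact S)
    (hSR : S ⊆ exteriorBall N R') :
    Tendsto (fun n => eLpNorm (fun x => φ n x - u x) (ENNReal.ofReal (sobolevExp N p))
      (volume.restrict S)) atTop (𝓝 0) := by
  have hp0 : 0 < p := by linarith
  obtain ⟨C, hC, hle⟩ := h.exists_eLpNorm_sub_le hp hpN hR₁ hR hRR hc hcL
  have h1 := (ENNReal.Tendsto.const_mul (a := C) h.tendsto_gradient (Or.inr hC)).ennrpow_const p⁻¹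
  rw [mul_zero, ENNReal.zero_rpow_of_pos (by positivity)] at h1
  refine tendsto_of_tendsto_of_tendsto_of_le_of_le tendsto_const_nhds h1 (fun _ => zero_le)
    fun n => ?_
  exact (ENNReal.le_rpow_inv_iff hp0).2 (hle n S hS hSR)

/-- One step of the De Giorgi iteration, obtained from `exists_truncation_le` by passing to the limit
along the approximating sequence. -/
theorem exists_one_step_constant (hp : 1 < p) (hpN : p < N) {R R' c q : ℝ} (hR₁ : 0 < R₁)
    (hR : R₁ < R) (hRR : R < R') (hc : 0 < c)
    (hcL : ∀ᵐ x ∂(volume.restrict (exteriorBall N R)), c ≤ L x) (hpq : p ≤ q)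
    (hq : q < sobolevExp N p) (h : ApproxSolution p R₁ L K lam u G φ) :
    ∃ C : ℝ≥0∞, C ≠ ∞ ∧ ∃ D : ℝ, 0 < D ∧ ∀ (x₀ : EuclideanSpace ℝ (Fin N)) (s r a k : ℝ) (M : ℝ≥0∞),
      0 ≤ s → s < r → Metric.closedBall x₀ r ⊆ exteriorBall N R' → 0 ≤ a → a < k → M ≠ ∞ →
      eLpNorm L (weightExponent p q) (volume.restrict (Metric.ball x₀ r)) ≤ M →
      eLpNorm K (weightExponent p q) (volume.restrict (Metric.ball x₀ r)) ≤ M →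
      eLpNorm (fun x => max (u x - k) 0) (ENNReal.ofReal (sobolevExp N p))
          (volume.restrict (Metric.ball x₀ s)) ^ p ≤
        C * (ENNReal.ofReal |lam| * ENNReal.ofReal (2 * k / (k - a)) ^ (p - 1) +
          ENNReal.ofReal (D / (r - s)) ^ p) * M *
          eLpNorm (fun x => max (u x - a) 0) (ENNReal.ofReal q)
            (volume.restrict (Metric.ball x₀ r)) ^ p := by
  have hp0 : 0 < p := by linarith
  obtain ⟨hq0, hps0, hβ⟩ := lt_sobolevExp_pos hp hpq hq
  have hps1 : 1 ≤ ENNReal.ofReal (sobolevExp N p) := by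
    rw [ENNReal.one_le_ofReal]; linarith
  have hq1 : 1 ≤ ENNReal.ofReal q := by rw [ENNReal.one_le_ofReal]; linarith
  obtain ⟨C₀, hC₀, D, hD, hle⟩ := h.exists_truncation_le hp hpN hR hc hcL
  set τ : ℝ≥0∞ := 2 ^ (p - 1) with hτ
  have hτf : τ ≠ ∞ := ENNReal.rpow_ne_top_of_nonneg (by linarith) (by simp)
  have hτ1 : 1 ≤ τ := ENNReal.one_le_rpow (by norm_num) (by linarith)
  refine ⟨τ * C₀ * τ, ENNReal.mul_ne_top (ENNReal.mul_ne_top hτf hC₀) hτf, D, hD, ?_⟩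
  intro x₀ s r a k M hs hsr hB ha hak hM hLM hKM
  set B := Metric.ball x₀ r with hBdef
  have hBc : B ⊆ Metric.closedBall x₀ r := Metric.ball_subset_closedBall
  have hBR : B ⊆ exteriorBall N R := fun x hx => hRR.trans (hB (hBc hx))
  have hBR₁ : B ⊆ exteriorBall N R₁ := fun x hx => hR.trans (hBR hx)
  have hsB : Metric.ball x₀ s ⊆ B := Metric.ball_subset_ball hsr.le
  have hKm : AEStronglyMeasurable K (volume.restrict B) :=
    (h.aemeasurable_K.mono_set hBR₁).aestronglyMeasurable
  have hLm : AEStronglyMeasurable L (volume.restrict B) :=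
    (h.aemeasurable_L.mono_set hBR₁).aestronglyMeasurable
  have hum : AEStronglyMeasurable u (volume.restrict B) := h.meas_u.mono_set hBR₁
  have hφm : ∀ n, AEStronglyMeasurable (φ n) (volume.restrict B) := fun n =>
    (h.isTest n).1.continuous.aestronglyMeasurable
  have hdm : ∀ n, AEStronglyMeasurable (fun x => φ n x - u x) (volume.restrict B) := fun n =>
    (hφm n).sub hum
  set Y := eLpNorm (fun x => max (u x - a) 0) (ENNReal.ofReal q) (volume.restrict B) with hY
  set d : ℕ → ℝ≥0∞ := fun n =>
    eLpNorm (fun x => φ n x - u x) (ENNReal.ofReal q) (volume.restrict B) with hd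
  set f : ℕ → ℝ≥0∞ := fun n => eLpNorm (fun x => φ n x - u x) (ENNReal.ofReal (sobolevExp N p))
    (volume.restrict (Metric.closedBall x₀ r)) with hf
  have hBfin : volume B ≠ ∞ := measure_ball_lt_top.ne
  have hflim : Tendsto f atTop (𝓝 0) :=
    h.tendsto_eLpNorm_sobolevExp hp hpN hR₁ hR hRR hc hcL (isCompact_closedBall _ _) hB
  have hdlim : Tendsto d atTop (𝓝 0) := by
    have hV : volume B ^ (1 / q - 1 / sobolevExp N p) ≠ ∞ :=
      ENNReal.rpow_ne_top_of_nonneg hβ.le hBfin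
    have h1 := ENNReal.Tendsto.mul_const hflim (b := volume B ^ (1 / q - 1 / sobolevExp N p))
      (Or.inr hV)
    rw [zero_mul] at h1
    refine tendsto_of_tendsto_of_tendsto_of_le_of_le tendsto_const_nhds h1 (fun _ => zero_le)
      fun n => ?_
    refine (eLpNorm_le_eLpNorm_mul_measure hq0 hq (hdm n)).trans ?_
    rw [Measure.restrict_apply_univ]
    gcongr
    exact eLpNorm_mono_measure _ (Measure.restrict_mono hBc le_rfl)
  have hU : eLpNorm u (ENNReal.ofReal q) (volume.restrict B) ≠ ∞ := by
    obtain ⟨n, hn⟩ := (hdlim.eventually (gt_mem_nhds one_pos)).exists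
    have h1 : eLpNorm (φ n) (ENNReal.ofReal q) (volume.restrict B) < ∞ := by
      have h2 : MemLp (φ n) (ENNReal.ofReal q) volume :=
        (h.isTest n).1.continuous.memLp_of_hasCompactSupport (h.isTest n).2.1
      exact h2.restrict B |>.2
    refine ne_of_lt ?_
    calc eLpNorm u (ENNReal.ofReal q) (volume.restrict B)
        = eLpNorm (φ n - fun x => φ n x - u x) (ENNReal.ofReal q) (volume.restrict B) := by
          congr 1; ext x; simp
      _ ≤ _ := eLpNorm_sub_le (hφm n) (hdm n) hq1
      _ < ∞ := ENNReal.add_lt_top.2 ⟨h1, hn.trans ENNReal.one_lt_top⟩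
  -- the terms on the right-hand side of the Caccioppoli inequality
  have bK : ∫⁻ x in B, ‖K x‖ₑ * ‖max (u x - a) 0‖ₑ ^ p ≤ M * Y ^ p :=
    (lintegral_mul_rpow_le_eLpNorm hp0 hpq hKm
      ((hum.aemeasurable.sub_const a).max aemeasurable_const).aestronglyMeasurable).trans
      (mul_le_mul_left hKM _)
  have bL : ∫⁻ x in B, ‖L x‖ₑ * ‖max (u x - a) 0‖ₑ ^ p ≤ M * Y ^ p :=
    (lintegral_mul_rpow_le_eLpNorm hp0 hpq hLm
      ((hum.aemeasurable.sub_const a).max aemeasurable_const).aestronglyMeasurable).trans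
      (mul_le_mul_left hLM _)
  have bLd : ∀ n, ∫⁻ x in B, ‖L x‖ₑ * ‖φ n x - u x‖ₑ ^ p ≤ M * d n ^ p := fun n =>
    (lintegral_mul_rpow_le_eLpNorm hp0 hpq hLm (hdm n)).trans (mul_le_mul_left hLM _)
  have bKd : ∀ n, ∫⁻ x in B, ‖K x‖ₑ * ‖φ n x - u x‖ₑ ^ p ≤ M * d n ^ p := fun n =>
    (lintegral_mul_rpow_le_eLpNorm hp0 hpq hKm (hdm n)).trans (mul_le_mul_left hKM _)
  have hdp : Tendsto (fun n => M * d n ^ p) atTop (𝓝 0) := by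
    have := ENNReal.Tendsto.const_mul (a := M) (hdlim.ennrpow_const p) (Or.inr hM)
    rwa [ENNReal.zero_rpow_of_pos hp0, mul_zero] at this
  set e : ℕ → ℝ≥0∞ := fun n => ∫⁻ x in B, ‖K x‖ₑ * (‖u x‖ₑ ^ (p - 1) * ‖φ n x - u x‖ₑ) with he
  have helim : Tendsto e atTop (𝓝 0) := by
    have hKu : ∫⁻ x in B, ‖K x‖ₑ * ‖u x‖ₑ ^ p ≠ ∞ :=
      ne_top_of_le_ne_top (ENNReal.mul_ne_top (ne_top_of_le_ne_top hM hKM)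
        (ENNReal.rpow_ne_top_of_nonneg hp0.le hU)) (lintegral_mul_rpow_le_eLpNorm hp0 hpq hKm hum)
    have h1 := ENNReal.Tendsto.const_mul
      (a := (∫⁻ x in B, ‖K x‖ₑ * ‖u x‖ₑ ^ p) ^ ((p - 1) / p)) (hdp.ennrpow_const (1 / p))
      (Or.inr (ENNReal.rpow_ne_top_of_nonneg (div_nonneg (by linarith) hp0.le) hKu))
    rw [ENNReal.zero_rpow_of_pos (by positivity), mul_zero] at h1
    refine tendsto_of_tendsto_of_tendsto_of_le_of_le tendsto_const_nhds h1 (fun _ => zero_le)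
      fun n => ?_
    refine (lintegral_weighted_holder hp hKm.enorm hum.enorm (hdm n).enorm).trans ?_
    gcongr
    exact bKd n
  set κ : ℝ≥0∞ := ENNReal.ofReal (2 * k / (k - a)) ^ (p - 1) with hκ
  set T : ℝ≥0∞ := ENNReal.ofReal (D / (r - s)) ^ p with hT
  have hTf : T ≠ ∞ := ENNReal.rpow_ne_top_of_nonneg hp0.le ENNReal.ofReal_ne_top
  set E₁ : ℕ → ℝ≥0∞ := fun n => ∫⁻ x in exteriorBall N R₁, ENNReal.ofReal (L x) *
    (‖G x‖ₑ ^ (p - 1) * ‖gradient (φ n) x - G x‖ₑ) with hE₁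
  set E₂ : ℕ → ℝ≥0∞ := fun n => ∫⁻ x in exteriorBall N R₁, ENNReal.ofReal (L x) *
    ‖gradient (φ n) x - G x‖ₑ ^ p with hE₂
  have hbound : ∀ n, eLpNorm (fun x => max (u x - k) 0) (ENNReal.ofReal (sobolevExp N p))
      (volume.restrict (Metric.ball x₀ s)) ^ p ≤
      τ * (C₀ * (ENNReal.ofReal |lam| * (κ * (M * Y ^ p) + e n) + E₁ n + E₂ n +
        T * (τ * (M * Y ^ p + M * d n ^ p))) + f n ^ p) := by
    intro n
    have h1 : eLpNorm (fun x => max (u x - k) 0) (ENNReal.ofReal (sobolevExp N p))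
        (volume.restrict (Metric.ball x₀ s)) ≤
        eLpNorm (fun x => max (φ n x - k) 0) (ENNReal.ofReal (sobolevExp N p))
          (volume.restrict (Metric.ball x₀ s)) + f n := by
      have hms : ∀ g : EuclideanSpace ℝ (Fin N) → ℝ, AEStronglyMeasurable g (volume.restrict B) →
          AEStronglyMeasurable g (volume.restrict (Metric.ball x₀ s)) := fun g hg => hg.mono_set hsB
      calc eLpNorm (fun x => max (u x - k) 0) (ENNReal.ofReal (sobolevExp N p))
            (volume.restrict (Metric.ball x₀ s))
          ≤ eLpNorm ((fun x => max (φ n x - k) 0) + fun x => ‖φ n x - u x‖)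
              (ENNReal.ofReal (sobolevExp N p)) (volume.restrict (Metric.ball x₀ s)) := by
            refine eLpNorm_mono fun x => ?_
            have h2 : 0 ≤ max (φ n x - k) 0 := le_max_right _ _
            rw [Pi.add_apply, Real.norm_of_nonneg (le_max_right _ _),
              Real.norm_of_nonneg (add_nonneg h2 (norm_nonneg _))]
            refine max_le ?_ (add_nonneg h2 (norm_nonneg _))
            have h3 := le_max_left (φ n x - k) 0
            have h4 := neg_abs_le (φ n x - u x)
            rw [Real.norm_eq_abs]
            linarith
        _ ≤ _ := eLpNorm_add_le (hms _ ((((hφm n).aemeasurable.sub_const k).max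
            aemeasurable_const).aestronglyMeasurable)) (hms _ (hdm n).norm) hps1
        _ ≤ _ := by
            rw [eLpNorm_norm]
            gcongr
            exact eLpNorm_mono_measure _ (Measure.restrict_mono (hsB.trans hBc) le_rfl)
    refine (ENNReal.rpow_le_rpow h1 hp0.le).trans
      ((ENNReal.rpow_add_le_mul_rpow_add_rpow _ _ hp.le).trans ?_)
    refine mul_le_mul_right (add_le_add ((hle n x₀ s r a k hs hsr hBR ha hak).trans ?_) le_rfl) _
    refine mul_le_mul_right (add_le_add (add_le_add (add_le_add (mul_le_mul_right
      (add_le_add (mul_le_mul_right bK _) le_rfl) _) le_rfl) le_rfl) ?_) _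
    exact mul_le_mul_right (mul_le_mul_right (add_le_add bL (bLd n)) _) _
  have hlim : Tendsto (fun n => τ * (C₀ * (ENNReal.ofReal |lam| * (κ * (M * Y ^ p) + e n) + E₁ n +
      E₂ n + T * (τ * (M * Y ^ p + M * d n ^ p))) + f n ^ p)) atTop
      (𝓝 (τ * (C₀ * (ENNReal.ofReal |lam| * (κ * (M * Y ^ p) + 0) + 0 + 0 +
        T * (τ * (M * Y ^ p + 0))) + 0))) := by
    have hfp : Tendsto (fun n => f n ^ p) atTop (𝓝 0) := by
      have := hflim.ennrpow_const p
      rwa [ENNReal.zero_rpow_of_pos hp0] at this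
    refine ENNReal.Tendsto.const_mul (Tendsto.add (ENNReal.Tendsto.const_mul
      (((Tendsto.add ?_ (h.tendsto_gradient_error hp)).add h.tendsto_gradient).add ?_)
      (Or.inr hC₀)) hfp) (Or.inr hτf)
    · exact ENNReal.Tendsto.const_mul (helim.const_add _) (Or.inr ENNReal.ofReal_ne_top)
    · exact ENNReal.Tendsto.const_mul (ENNReal.Tendsto.const_mul (hdp.const_add _) (Or.inr hτf))
        (Or.inr hTf)
  refine (ge_of_tendsto' hlim hbound).trans ?_
  simp only [add_zero]
  calc τ * (C₀ * (ENNReal.ofReal |lam| * (κ * (M * Y ^ p)) + T * (τ * (M * Y ^ p))))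
      ≤ τ * (C₀ * (τ * (ENNReal.ofReal |lam| * (κ * (M * Y ^ p))) + T * (τ * (M * Y ^ p)))) := by
        exact mul_le_mul_right (mul_le_mul_right (add_le_add (le_mul_of_one_le_left' hτ1) le_rfl) _) _
    _ = _ := by ring


/-- De Giorgi's theorem: if the norm of `u` in `L^q(B(x₀, r₀))` is at most `δ`, then `u ≤ k` in
`B(x₀, r₀ / 2)`, where `δ` does not depend on `x₀`. -/
theorem exists_smallness (hp : 1 < p) (hpN : p < N) {R R' c q r₀ k : ℝ} (hR₁ : 0 < R₁)
    (hR : R₁ < R) (hRR : R < R') (hc : 0 < c)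
    (hcL : ∀ᵐ x ∂(volume.restrict (exteriorBall N R)), c ≤ L x) (hpq : p ≤ q)
    (hq : q < sobolevExp N p) (hr₀ : 0 < r₀) (hk : 0 < k) {M : ℝ≥0∞} (hM : M ≠ ∞)
    (h : ApproxSolution p R₁ L K lam u G φ) :
    ∃ δ : ℝ≥0∞, 0 < δ ∧ ∀ x₀ : EuclideanSpace ℝ (Fin N),
      Metric.closedBall x₀ r₀ ⊆ exteriorBall N R' →
      eLpNorm L (weightExponent p q) (volume.restrict (Metric.ball x₀ r₀)) ≤ M →
      eLpNorm K (weightExponent p q) (volume.restrict (Metric.ball x₀ r₀)) ≤ M →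
      eLpNorm u (ENNReal.ofReal q) (volume.restrict (Metric.ball x₀ r₀)) ≤ δ →
      ∀ᵐ x ∂(volume.restrict (Metric.ball x₀ (r₀ / 2))), u x ≤ k := by
  have hp0 : 0 < p := by linarith
  obtain ⟨hq0, hps0, hβ⟩ := lt_sobolevExp_pos hp hpq hq
  obtain ⟨C, hC, D, hD, hstep⟩ :=
    h.exists_one_step_constant hp hpN hR₁ hR hRR hc hcL hpq hq
  set α : ℝ := 1 - q / sobolevExp N p with hα
  have hα0 : 0 < α := by rw [hα, sub_pos, div_lt_one hps0]; exact hq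
  set A : ℝ := |lam| * 4 ^ (p - 1) + (4 * D / r₀) ^ p with hA
  have hA0 : 0 ≤ A := by positivity
  set C₁ : ℝ≥0∞ := (C * ENNReal.ofReal A * M) ^ p⁻¹ with hC₁
  have hC₁f : C₁ ≠ ∞ := ENNReal.rpow_ne_top_of_nonneg (by positivity)
    (ENNReal.mul_ne_top (ENNReal.mul_ne_top hC ENNReal.ofReal_ne_top) hM)
  set C₂ : ℝ := (C₁.toReal + 1) * (2 / k) ^ α with hC₂
  have hC₂0 : 0 < C₂ := by positivity
  have hB : (1 : ℝ) < 2 ^ (1 + α) := Real.one_lt_rpow (by norm_num) (by linarith)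
  obtain ⟨δ, hδ, hdecay⟩ := exists_fast_decay hC₂0 hB hα0
  refine ⟨δ, hδ, fun x₀ hx₀ hL hK hu => ?_⟩
  -- levels increasing to `k`, radii decreasing to `r₀ / 2`
  set l : ℕ → ℝ := fun j => k * (1 - (2 ^ j)⁻¹) with hl
  set r : ℕ → ℝ := fun j => r₀ / 2 * (1 + (2 ^ j)⁻¹) with hr
  have hpow : ∀ j : ℕ, (0 : ℝ) < 2 ^ j := fun j => by positivity
  have hpow1 : ∀ j : ℕ, (1 : ℝ) ≤ 2 ^ j := fun j => one_le_pow₀ (by norm_num)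
  have hinv : ∀ j : ℕ, ((2 : ℝ) ^ (j + 1))⁻¹ = (2 ^ j)⁻¹ / 2 := fun j => by
    rw [pow_succ, mul_inv]; ring
  have hinv0 : ∀ j : ℕ, (0 : ℝ) < (2 ^ j)⁻¹ := fun j => by positivity
  have hinv1 : ∀ j : ℕ, ((2 : ℝ) ^ j)⁻¹ ≤ 1 := fun j => inv_le_one_of_one_le₀ (hpow1 j)
  have hl0 : ∀ j, 0 ≤ l j := fun j => mul_nonneg hk.le (by linarith [hinv1 j])
  have hld : ∀ j, l (j + 1) - l j = k / 2 * (2 ^ j)⁻¹ := fun j => by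
    simp only [hl, hinv]; ring
  have hlk : ∀ j, l j ≤ k := fun j => by
    simp only [hl]; nlinarith [hinv0 j]
  have hrd : ∀ j, r j - r (j + 1) = r₀ / 4 * (2 ^ j)⁻¹ := fun j => by
    simp only [hr, hinv]; ring
  have hr₀2 : ∀ j, r₀ / 2 ≤ r j := fun j => by
    simp only [hr]; nlinarith [hinv0 j]
  have hrr₀ : ∀ j, r j ≤ r₀ := fun j => by
    simp only [hr]; nlinarith [hinv1 j]
  have hllt : ∀ j, l j < l (j + 1) := fun j => by
    have : 0 < k / 2 * ((2 : ℝ) ^ j)⁻¹ := by positivity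
    linarith [hld j]
  have hrlt : ∀ j, r (j + 1) < r j := fun j => by
    have : 0 < r₀ / 4 * ((2 : ℝ) ^ j)⁻¹ := by positivity
    linarith [hrd j]
  have hBsub : ∀ j, Metric.ball x₀ (r j) ⊆ Metric.ball x₀ r₀ := fun j =>
    Metric.ball_subset_ball (hrr₀ j)
  have hBR₁ : Metric.ball x₀ r₀ ⊆ exteriorBall N R₁ := fun x hx =>
    hR.trans (hRR.trans (hx₀ (Metric.ball_subset_closedBall hx)))
  have hum : ∀ j, AEStronglyMeasurable u (volume.restrict (Metric.ball x₀ (r j))) := fun j =>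
    h.meas_u.mono_set ((hBsub j).trans hBR₁)
  set Y : ℕ → ℝ≥0∞ := fun j => eLpNorm (fun x => max (u x - l j) 0) (ENNReal.ofReal q)
    (volume.restrict (Metric.ball x₀ (r j))) with hY
  have hY0 : Y 0 ≤ δ := by
    refine le_trans (le_trans (eLpNorm_mono (g := u) fun x => ?_)
      (eLpNorm_mono_measure _ (Measure.restrict_mono (hBsub 0) le_rfl))) hu
    rw [Real.norm_of_nonneg (le_max_right _ _), Real.norm_eq_abs]
    refine max_le ?_ (abs_nonneg _)
    linarith [le_abs_self (u x), hl0 0]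
  have hYstep : ∀ j, Y (j + 1) ≤
      ENNReal.ofReal (C₂ * ((2 : ℝ) ^ (1 + α)) ^ j) * Y j ^ (1 + α) := by
    intro j
    set t : ℝ := 2 ^ j with ht
    have ht0 : 0 < t := hpow j
    have ht1 : 1 ≤ t := hpow1 j
    have hldj : l (j + 1) - l j = k / 2 * t⁻¹ := hld j
    have hrdj : r j - r (j + 1) = r₀ / 4 * t⁻¹ := hrd j
    have hLj : eLpNorm L (weightExponent p q) (volume.restrict (Metric.ball x₀ (r j))) ≤ M :=
      (eLpNorm_mono_measure _ (Measure.restrict_mono (hBsub j) le_rfl)).trans hL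
    have hKj : eLpNorm K (weightExponent p q) (volume.restrict (Metric.ball x₀ (r j))) ≤ M :=
      (eLpNorm_mono_measure _ (Measure.restrict_mono (hBsub j) le_rfl)).trans hK
    have h1 := hstep x₀ (r (j + 1)) (r j) (l j) (l (j + 1)) M
      ((half_pos hr₀).le.trans (hr₀2 _)) (hrlt j)
      ((Metric.closedBall_subset_closedBall (hrr₀ j)).trans hx₀) (hl0 j) (hllt j) hM hLj hKj
    have h2 : ENNReal.ofReal |lam| * ENNReal.ofReal (2 * l (j + 1) / (l (j + 1) - l j)) ^ (p - 1) +
        ENNReal.ofReal (D / (r j - r (j + 1))) ^ p ≤ ENNReal.ofReal A * ENNReal.ofReal t ^ p := by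
      have e1 : 2 * l (j + 1) / (l (j + 1) - l j) ≤ 4 * t := by
        rw [hldj, div_le_iff₀ (by positivity)]
        have : 4 * t * (k / 2 * t⁻¹) = 2 * k := by field_simp; norm_num
        rw [this]
        linarith [hlk (j + 1)]
      have e2 : D / (r j - r (j + 1)) = 4 * D / r₀ * t := by
        rw [hrdj]; field_simp
      have e3 : 0 ≤ 2 * l (j + 1) / (l (j + 1) - l j) :=
        div_nonneg (by linarith [hl0 (j + 1)]) (by linarith [hllt j])
      rw [e2, ENNReal.ofReal_rpow_of_nonneg e3 (by linarith),
        ENNReal.ofReal_rpow_of_nonneg (by positivity) hp0.le,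
        ENNReal.ofReal_rpow_of_nonneg ht0.le hp0.le, ← ENNReal.ofReal_mul (abs_nonneg _),
        ← ENNReal.ofReal_mul hA0, ← ENNReal.ofReal_add (by positivity) (by positivity)]
      apply ENNReal.ofReal_le_ofReal
      have e4 : (2 * l (j + 1) / (l (j + 1) - l j)) ^ (p - 1) ≤ 4 ^ (p - 1) * t ^ p := by
        calc _ ≤ (4 * t) ^ (p - 1) := Real.rpow_le_rpow e3 e1 (by linarith)
          _ = 4 ^ (p - 1) * t ^ (p - 1) := Real.mul_rpow (by norm_num) ht0.le
          _ ≤ _ := by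
            gcongr
            linarith
      rw [hA, Real.mul_rpow (by positivity) ht0.le, add_mul, mul_assoc |lam|]
      gcongr
    have h3 : eLpNorm (fun x => max (u x - l (j + 1)) 0) (ENNReal.ofReal (sobolevExp N p))
        (volume.restrict (Metric.ball x₀ (r (j + 1)))) ≤ C₁ * ENNReal.ofReal t * Y j := by
      have e5 : C₁ * ENNReal.ofReal t * Y j =
          (C * (ENNReal.ofReal A * ENNReal.ofReal t ^ p) * M * Y j ^ p) ^ p⁻¹ := by
        have e6 : C * (ENNReal.ofReal A * ENNReal.ofReal t ^ p) * M * Y j ^ p =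
            C * ENNReal.ofReal A * M * (ENNReal.ofReal t * Y j) ^ p := by
          rw [ENNReal.mul_rpow_of_nonneg _ _ hp0.le]; ring
        rw [e6, ENNReal.mul_rpow_of_nonneg _ _ (by positivity), ENNReal.rpow_rpow_inv hp0.ne',
          mul_assoc]
      rw [e5, ENNReal.le_rpow_inv_iff hp0]
      refine h1.trans ?_
      gcongr
    have h4 := eLpNorm_truncation_le hq0 hq (hllt j) (hum (j + 1))
    have h5 : eLpNorm (fun x => max (u x - l j) 0) (ENNReal.ofReal q)
        (volume.restrict (Metric.ball x₀ (r (j + 1)))) ≤ Y j :=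
      eLpNorm_mono_measure _
        (Measure.restrict_mono (Metric.ball_subset_ball (hrlt j).le) le_rfl)
    have h6 : (ENNReal.ofReal (l (j + 1) - l j))⁻¹ = ENNReal.ofReal (2 / k * t) := by
      rw [← ENNReal.ofReal_inv_of_pos (by linarith [hllt j]), hldj]
      congr 1
      field_simp
    rw [h6] at h4
    calc Y (j + 1) ≤ _ := h4
      _ ≤ (C₁ * ENNReal.ofReal t * Y j) * (ENNReal.ofReal (2 / k * t) * Y j) ^ α := by gcongr
      _ ≤ (ENNReal.ofReal (C₁.toReal + 1) * ENNReal.ofReal t * Y j) *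
            (ENNReal.ofReal (2 / k * t) * Y j) ^ α := by
          gcongr
          rw [← ENNReal.ofReal_toReal hC₁f]
          apply ENNReal.ofReal_le_ofReal
          rw [ENNReal.toReal_ofReal ENNReal.toReal_nonneg]
          linarith
      _ = _ := by
          rw [ENNReal.mul_rpow_of_nonneg _ _ hα0.le, ENNReal.rpow_add_of_nonneg 1 α zero_le_one hα0.le,
            ENNReal.rpow_one, ENNReal.ofReal_rpow_of_nonneg (by positivity) hα0.le]
          have e7 : C₂ * ((2 : ℝ) ^ (1 + α)) ^ j = (C₁.toReal + 1) * t * (2 / k * t) ^ α := by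
            rw [hC₂, Real.mul_rpow (by positivity) ht0.le, ← Real.rpow_natCast, ← Real.rpow_mul
              (by norm_num), mul_comm (1 + α), Real.rpow_mul (by norm_num), Real.rpow_natCast,
              Real.rpow_add ht0, Real.rpow_one]
            ring
          rw [e7, ENNReal.ofReal_mul (by positivity), ENNReal.ofReal_mul (by positivity)]
          ring
  have hlim := hdecay Y hY0 hYstep
  have hzero : eLpNorm (fun x => max (u x - k) 0) (ENNReal.ofReal q)
      (volume.restrict (Metric.ball x₀ (r₀ / 2))) = 0 := by
    refine le_antisymm (ge_of_tendsto' hlim fun j => ?_) zero_le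
    refine (eLpNorm_mono fun x => ?_).trans
      (eLpNorm_mono_measure _ (Measure.restrict_mono (Metric.ball_subset_ball (hr₀2 j)) le_rfl))
    rw [Real.norm_of_nonneg (le_max_right _ _), Real.norm_of_nonneg (le_max_right _ _)]
    exact max_le_max (by linarith [hlk j]) le_rfl
  have hm : AEStronglyMeasurable (fun x => max (u x - k) 0)
      (volume.restrict (Metric.ball x₀ (r₀ / 2))) :=
    (((h.meas_u.mono_set ((Metric.ball_subset_ball (by linarith)).trans hBR₁)).aemeasurable.sub_const
      k).max aemeasurable_const).aestronglyMeasurable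
  rw [eLpNorm_eq_zero_iff hm (by simpa using hq0)] at hzero
  filter_upwards [hzero] with x hx
  have := le_max_left (u x - k) 0
  rw [show max (u x - k) 0 = 0 from hx] at this
  linarith

/-- The local norms of a solution tend to zero at infinity. -/
theorem exists_eLpNorm_le_at_infinity (hp : 1 < p) (hpN : p < N) {R R' c q : ℝ} (r₀ : ℝ)
    (hR₁ : 0 < R₁) (hR : R₁ < R) (hRR : R < R') (hc : 0 < c)
    (hcL : ∀ᵐ x ∂(volume.restrict (exteriorBall N R)), c ≤ L x) (hpq : p ≤ q)
    (hq : q < sobolevExp N p) (h : ApproxSolution p R₁ L K lam u G φ) {δ : ℝ≥0∞} (hδ : 0 < δ) :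
    ∃ ρ : ℝ, ∀ x₀ : EuclideanSpace ℝ (Fin N), ρ < ‖x₀‖ →
      Metric.closedBall x₀ r₀ ⊆ exteriorBall N R' →
      eLpNorm u (ENNReal.ofReal q) (volume.restrict (Metric.ball x₀ r₀)) ≤ δ := by
  have hp0 : 0 < p := by linarith
  obtain ⟨hq0, hps0, hβ⟩ := lt_sobolevExp_pos hp hpq hq
  obtain ⟨C, hC, hle⟩ := h.exists_eLpNorm_sub_le hp hpN hR₁ hR hRR hc hcL
  set V : ℝ≥0∞ := volume (Metric.ball (0 : EuclideanSpace ℝ (Fin N)) r₀) ^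
    (1 / q - 1 / sobolevExp N p) with hV
  have hVf : V ≠ ∞ := ENNReal.rpow_ne_top_of_nonneg hβ.le measure_ball_lt_top.ne
  have h1 := (ENNReal.Tendsto.const_mul (a := C) h.tendsto_gradient (Or.inr hC)).ennrpow_const p⁻¹
  rw [mul_zero, ENNReal.zero_rpow_of_pos (by positivity)] at h1
  have h2 := ENNReal.Tendsto.mul_const h1 (b := V) (Or.inr hVf)
  rw [zero_mul] at h2
  -- `φ n` is close to `u` in `L^q` on all balls, and vanishes on those far from the origin
  obtain ⟨n, hn⟩ := (h2.eventually (ge_mem_nhds hδ)).exists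
  obtain ⟨ρ, hρ⟩ := (h.isTest n).2.1.isCompact.isBounded.subset_closedBall 0
  refine ⟨ρ + r₀, fun x₀ hx₀ hB => ?_⟩
  have hBR₁ : Metric.ball x₀ r₀ ⊆ exteriorBall N R₁ := fun x hx =>
    hR.trans (hRR.trans (hB (Metric.ball_subset_closedBall hx)))
  have hzero : ∀ x ∈ Metric.ball x₀ r₀, φ n x = 0 := by
    intro x hx
    refine image_eq_zero_of_notMem_tsupport fun hxt => ?_
    have h3 : ‖x‖ ≤ ρ := by simpa using hρ hxt
    rw [Metric.mem_ball, dist_eq_norm, norm_sub_rev] at hx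
    have := norm_le_norm_add_norm_sub' x₀ x
    linarith
  calc eLpNorm u (ENNReal.ofReal q) (volume.restrict (Metric.ball x₀ r₀))
      = eLpNorm (fun x => φ n x - u x) (ENNReal.ofReal q) (volume.restrict (Metric.ball x₀ r₀)) := by
        refine eLpNorm_congr_norm_ae ?_
        filter_upwards [ae_restrict_mem measurableSet_ball] with x hx
        rw [hzero x hx, zero_sub, norm_neg]
    _ ≤ _ := eLpNorm_le_eLpNorm_mul_measure hq0 hq
        ((h.isTest n).1.continuous.aestronglyMeasurable.sub (h.meas_u.mono_set hBR₁))
    _ ≤ _ := by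
        rw [Measure.restrict_apply_univ, Measure.addHaar_ball_center]
        refine mul_le_mul_left ((eLpNorm_mono_measure _ (Measure.restrict_mono
          Metric.ball_subset_closedBall le_rfl)).trans ((ENNReal.le_rpow_inv_iff hp0).2
            (hle n _ (isCompact_closedBall _ _) hB))) _
    _ ≤ δ := hn

/-- Smallness of the solution from above on all balls of radius `r₀ / 2` far away from the origin. -/
theorem exists_le_at_infinity (hp : 1 < p) (hpN : p < N) {R R' c q r₀ k : ℝ} (hR₁ : 0 < R₁)
    (hR : R₁ < R) (hRR : R < R') (hc : 0 < c)
    (hcL : ∀ᵐ x ∂(volume.restrict (exteriorBall N R)), c ≤ L x) (hpq : p ≤ q)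
    (hq : q < sobolevExp N p) (hr₀ : 0 < r₀) (hk : 0 < k) {M : ℝ≥0∞} (hM : M ≠ ∞)
    (h : ApproxSolution p R₁ L K lam u G φ) :
    ∃ ρ : ℝ, ∀ x₀ : EuclideanSpace ℝ (Fin N), ρ < ‖x₀‖ →
      eLpNorm L (weightExponent p q) (volume.restrict (Metric.ball x₀ r₀)) ≤ M →
      eLpNorm K (weightExponent p q) (volume.restrict (Metric.ball x₀ r₀)) ≤ M →
      ∀ᵐ x ∂(volume.restrict (Metric.ball x₀ (r₀ / 2))), u x ≤ k := by
  obtain ⟨δ, hδ, hsmall⟩ := h.exists_smallness hp hpN hR₁ hR hRR hc hcL hpq hq hr₀ hk hM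
  obtain ⟨ρ, hρ⟩ := h.exists_eLpNorm_le_at_infinity hp hpN r₀ hR₁ hR hRR hc hcL hpq hq hδ
  refine ⟨max ρ (R' + r₀), fun x₀ hx₀ hL hK => ?_⟩
  have hB : Metric.closedBall x₀ r₀ ⊆ exteriorBall N R' := by
    intro x hx
    rw [Metric.mem_closedBall, dist_eq_norm, norm_sub_rev] at hx
    have h1 := norm_le_norm_add_norm_sub' x₀ x
    have h2 := (le_max_right _ _).trans_lt hx₀
    change R' < ‖x‖
    linarith
  exact hsmall x₀ hB hL hK (hρ x₀ ((le_max_left _ _).trans_lt hx₀) hB)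

end ApproxSolution

end WeightedPLaplacian

theorem corollary1p8 (N : ℕ) (p R₁ : ℝ) (hp : 1 < p) (hpN : p < N) (hR₁ : 0 < R₁)
    (L K : EuclideanSpace ℝ (Fin N) → ℝ)
    (hLK : WeightedPLaplacian.StandingWeights N R₁ L K)
    (hA : WeightedPLaplacian.ConditionA N p R₁ L K)
    (R : ℝ) (hR : R₁ < R)
    (hLpos : ∃ c : ℝ, 0 < c ∧
      ∀ᵐ x ∂(volume.restrict (WeightedPLaplacian.exteriorBall N R)), c ≤ L x)
    (q : ℝ) (hpq : p ≤ q) (hq : q < N * p / (N - p))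
    (hLloc : WeightedPLaplacian.MemLpLoc (WeightedPLaplacian.weightExponent p q)
      (WeightedPLaplacian.exteriorBall N R) L)
    (hKloc : WeightedPLaplacian.MemLpLoc (WeightedPLaplacian.weightExponent p q)
      (WeightedPLaplacian.exteriorBall N R) K)
    (r₀ : ℝ) (hr₀ : 0 < r₀) (hr₀R : r₀ < R - R₁)
    (hbdd : essSup (fun x : EuclideanSpace ℝ (Fin N) =>
        eLpNorm L (WeightedPLaplacian.weightExponent p q) (volume.restrict (Metric.ball x r₀)) +
        eLpNorm K (WeightedPLaplacian.weightExponent p q) (volume.restrict (Metric.ball x r₀)))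
      (volume.restrict (WeightedPLaplacian.exteriorBall N R)) < ∞)
    (lam : ℝ) (u : EuclideanSpace ℝ (Fin N) → ℝ)
    (hu : WeightedPLaplacian.IsWeakSolution p (WeightedPLaplacian.exteriorBall N R₁) L K lam u) :
    ∀ ε : ℝ, 0 < ε → ∃ ρ : ℝ, R₁ ≤ ρ ∧
      ∀ᵐ x ∂(volume.restrict (WeightedPLaplacian.exteriorBall N ρ)), |u x| < ε := by
  intro ε hε
  obtain ⟨c, hc, hcL⟩ := hLpos
  obtain ⟨G, φ, h⟩ := hu.exists_approxSolution hp hLK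
  set M := essSup (fun x : EuclideanSpace ℝ (Fin N) =>
        eLpNorm L (WeightedPLaplacian.weightExponent p q) (volume.restrict (Metric.ball x r₀)) +
        eLpNorm K (WeightedPLaplacian.weightExponent p q) (volume.restrict (Metric.ball x r₀)))
      (volume.restrict (WeightedPLaplacian.exteriorBall N R)) with hM
  have hgood := ENNReal.ae_le_essSup (μ := volume.restrict (WeightedPLaplacian.exteriorBall N R))
    (fun x : EuclideanSpace ℝ (Fin N) =>
        eLpNorm L (WeightedPLaplacian.weightExponent p q) (volume.restrict (Metric.ball x r₀)) +
        eLpNorm K (WeightedPLaplacian.weightExponent p q) (volume.restrict (Metric.ball x r₀)))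
  rw [ae_restrict_iff' (WeightedPLaplacian.measurableSet_exteriorBall N R)] at hgood
  obtain ⟨ρ₁, hρ₁⟩ := h.exists_le_at_infinity hp hpN hR₁ hR (lt_add_one R) hc hcL hpq hq hr₀
    (half_pos hε) hbdd.ne
  obtain ⟨ρ₂, hρ₂⟩ := h.neg.exists_le_at_infinity hp hpN hR₁ hR (lt_add_one R) hc hcL hpq hq hr₀
    (half_pos hε) hbdd.ne
  set ρ := max R (max ρ₁ ρ₂) with hρ
  refine ⟨ρ + r₀, by linarith [le_max_left R (max ρ₁ ρ₂)], ?_⟩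
  rw [ae_restrict_iff' (WeightedPLaplacian.measurableSet_exteriorBall N _), ae_iff]
  refine measure_null_of_locally_null _ fun y hy => ?_
  have hy' : ρ + r₀ < ‖y‖ := by
    by_contra hcon
    exact hy fun hmem => absurd hmem hcon
  -- a centre close to `y` at which the bound on the weights holds
  obtain ⟨x₀, hx₀y, hx₀⟩ : ∃ x₀ ∈ Metric.ball y (r₀ / 2), x₀ ∈ WeightedPLaplacian.exteriorBall N R →
      eLpNorm L (WeightedPLaplacian.weightExponent p q) (volume.restrict (Metric.ball x₀ r₀)) +
        eLpNorm K (WeightedPLaplacian.weightExponent p q) (volume.restrict (Metric.ball x₀ r₀)) ≤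
          M := by
    have hpos : 0 < volume (Metric.ball y (r₀ / 2)) := Metric.measure_ball_pos _ _ (half_pos hr₀)
    by_contra! hcon
    refine hpos.ne' (measure_mono_null (fun x hx => ?_) hgood)
    intro hx'
    exact absurd (hx' (hcon x hx).1) (not_le.2 (hcon x hx).2)
  have hx₀n : ρ < ‖x₀‖ := by
    rw [Metric.mem_ball, dist_eq_norm, norm_sub_rev] at hx₀y
    have := norm_le_norm_add_norm_sub' y x₀
    linarith
  have hM₀ := hx₀ ((le_max_left R _).trans_lt hx₀n)
  have h1 := hρ₁ x₀ (((le_max_left _ _).trans (le_max_right _ _)).trans_lt hx₀n)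
    (le_self_add.trans hM₀) (le_add_self.trans hM₀)
  have h2 := hρ₂ x₀ (((le_max_right _ _).trans (le_max_right _ _)).trans_lt hx₀n)
    (le_self_add.trans hM₀) (le_add_self.trans hM₀)
  have h3 : ∀ᵐ x ∂(volume.restrict (Metric.ball x₀ (r₀ / 2))), |u x| < ε := by
    filter_upwards [h1, h2] with x hx1 hx2
    rw [abs_lt]
    constructor <;> linarith
  rw [ae_restrict_iff' measurableSet_ball, ae_iff] at h3
  refine ⟨Metric.ball x₀ (r₀ / 2) ∩ {x | ¬(x ∈ WeightedPLaplacian.exteriorBall N (ρ + r₀) →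
    |u x| < ε)}, ?_, measure_mono_null (fun x hx => ?_) h3⟩
  · exact inter_mem (mem_nhdsWithin_of_mem_nhds (Metric.isOpen_ball.mem_nhds
      (Metric.mem_ball_comm.1 hx₀y))) self_mem_nhdsWithin
  · exact fun hx' => hx.2 fun _ => hx' hx.1
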